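/- Let $d\ge 1$ and use the Fourier transform $\widehat f(\xi)=\int_{\mathbb R^d} f(y)e^{-i\langle y,\xi\rangle}\,dy$. Let $\varphi\in C_c^\infty(\mathbb R^d)$ be any radial function with $\operatorname{supp}\varphi\subset\{3/4<|\xi|<7/4\}$, $\varphi(\xi)=1$ for $7/8\le|\xi|\le 9/8$, and $\sum_{k\in\mathbb Z}\varphi(2^{-k}\xi)=1$ for all $\xi\ne0$. Let $\widehat{L_kf}(\xi)=\varphi(2^{-k}\xi)\widehat f(\xi)$ for $k\in\mathbb Z$, and let Ł$_k=L_k$ for $k\ge1$, Ł$_0=\mathrm{Id}-\sum_{k\ge1}L_k$. Let $\mathcal S_\infty(\mathbb R^d)$ be the space of Schwartz functions whose Fourier transforms vanish to infinite order at $0$, with the topology inherited from the Schwartz space, and let $\mathcal S_\infty'(\mathbb R^d)$ be its dual. (For $f$ in $\mathcal S_\infty'(\mathbb R^d)$, respectively in $\mathcal S'(\mathbb R^d)$, $L_kf$, respectively Ł$_kf$, is a smooth function.) For a measure space $(\Omega,\mu)$ and $1<p<\infty$, $L^{p,r}(\mu)$ is the space of measurable $g$ for which $$[g]_{L^{p,r}(\mu)}=\Big(r\int_0^\infty\lambda^r\mu(\{|g|>\lambda\})^{r/p}\,\frac{d\lambda}\lambda\Big)^{1/r}\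 (1\le r<\infty),\qquad [g]_{L^{p,\infty}(\mu)}=\sup_{\lambda>0}\lambda\,\mu(\{|g|>\lambda\})^{1/p}$$ is finite. For $s,\gamma\in\mathbb R$, $1<p<\infty$ and $1\le r\le\infty$ define: * $\dot{\mathcal B}^s_p(\gamma,r)$ is the set of $f\in\mathcal S'_\infty(\mathbb R^d)$ such that $(x,k)\mapsto 2^{k(s+\gamma/p)}L_kf(x)$ belongs to $L^{p,r}(\mathbb R^d\times\mathbb Z,\mu_\gamma)$, where $\mu_\gamma(E)=\sum_{k\in\mathbb Z}2^{-k\gamma}\int_{\mathbb R^d}\mathbf 1_E(x,k)\,dx$. * $\dot B^s_{p,r}$ is the set of $f\in\mathcal S'_\infty(\mathbb R^d)$ with $\big(\sum_{k\in\mathbb Z}\|2^{ks}L_kf\|_{L^p(\mathbb R^d)}^r\big)^{1/r}<\infty$ (supremum over $k$ if $r=\infty$). * The inhomogeneous spaces $\mathcal B^s_p(\gamma,r)$ and $B^s_{p,r}$ are the sets of tempered distributions $f\in\mathcal S'(\mathbb R^d)$ defined in the same way, with Ł$_k$ in place of $L_k$ and with $k$ ranging over $\{0,1,2,\dots\}$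 in place of $\mathbb Z$. **Theorem.** Let $s\in\mathbb R$ and $1<p<r\le\infty$. Then: (i) for all $\gamma\in\mathbb R$, $\ \dot B^s_{p,r}\setminus\dot{\mathcal B}^s_p(\gamma,\infty)\ne\emptyset$; (ii) for all $\beta,\gamma\in\mathbb R$ with $\beta\ne\gamma$, $\ \dot{\mathcal B}^s_p(\beta,r)\setminus\dot{\mathcal B}^s_p(\gamma,\infty)\ne\emptyset$. The same holds for the inhomogeneous spaces: $B^s_{p,r}\setminus\mathcal B^s_p(\gamma,\infty)\ne\emptyset$ for all $\gamma\in\mathbb R$, and $\mathcal B^s_p(\beta,r)\setminus\mathcal B^s_p(\gamma,\infty)\ne\emptyset$ for all $\beta\ne\gamma$. -/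

import Mathlib

open MeasureTheory Set
open scoped ENNReal SchwartzMap FourierTransform ContDiff

noncomputable section

namespace BesovLorentz

/-- The space `ℝ^d` with its Euclidean norm. -/
abbrev Space (d : ℕ) : Type := EuclideanSpace ℝ (Fin d)

/-- A generator of a Littlewood-Paley decomposition: a radial function `φ ∈ C_c^∞(ℝ^d)`, supported
in `{3/4 < |ξ| < 7/4}`, equal to `1` for `7/8 ≤ |ξ| ≤ 9/8`, with `∑_{k ∈ ℤ} φ(2^{-k} ξ) = 1` for all
`ξ ≠ 0`. -/
structure LPGenerator (d : ℕ) where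
  toFun : Space d → ℂ
  contDiff : ContDiff ℝ ∞ toFun
  radial : ∀ ξ η : Space d, ‖ξ‖ = ‖η‖ → toFun ξ = toFun η
  tsupport_subset : tsupport toFun ⊆ {ξ | 3 / 4 < ‖ξ‖ ∧ ‖ξ‖ < 7 / 4}
  eq_one : ∀ ξ : Space d, 7 / 8 ≤ ‖ξ‖ → ‖ξ‖ ≤ 9 / 8 → toFun ξ = 1
  hasSum : ∀ ξ : Space d, ξ ≠ 0 → HasSum (fun k : ℤ => toFun ((2 : ℝ) ^ (-k) • ξ)) 1

variable {d : ℕ}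

/-- The symbol `φ(2^{-k} ξ)` of `L_k`. Mathlib's Fourier transform is
`𝓕 f ζ = ∫ f(y) e^{-2πi⟨y,ζ⟩} dy`, so the frequency `ξ` of `∫ f(y) e^{-i⟨y,ξ⟩} dy` is `ξ = 2πζ`. -/
def symbol (φ : LPGenerator d) (k : ℤ) (ζ : Space d) : ℂ :=
  φ.toFun ((2 : ℝ) ^ (-k) • (2 * Real.pi) • ζ)

/-- The symbols of the inhomogeneous localizations: `L_k` for `k > 0`, and
`Id - ∑_{j > 0} L_j` for `k = 0`. -/
def inhomSymbol (φ : LPGenerator d) (k : ℕ) (ζ : Space d) : ℂ :=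
  if k = 0 then 1 - ∑' j : ℕ, symbol φ (j + 1 : ℕ) ζ else symbol φ k ζ

/-! ### Auxiliary facts: the symbols are smooth with compact support -/

lemma toFun_eq_zero_of_le (φ : LPGenerator d) {ξ : Space d} (h : ‖ξ‖ ≤ 3 / 4) : φ.toFun ξ = 0 := by
  by_contra hne
  have := φ.tsupport_subset (subset_tsupport _ hne)
  exact absurd this.1 (not_lt.mpr h)

lemma toFun_eq_zero_of_ge (φ : LPGenerator d) {ξ : Space d} (h : 7 / 4 ≤ ‖ξ‖) : φ.toFun ξ = 0 := by
  by_contra hne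
  have := φ.tsupport_subset (subset_tsupport _ hne)
  exact absurd this.2 (not_lt.mpr h)

lemma norm_arg (k : ℤ) (ζ : Space d) :
    ‖(2 : ℝ) ^ (-k) • (2 * Real.pi) • ζ‖ = (2 : ℝ) ^ (-k) * (2 * Real.pi * ‖ζ‖) := by
  have h2 : (0 : ℝ) < (2 : ℝ) ^ (-k) := by positivity
  have hp : (0 : ℝ) < 2 * Real.pi := by positivity
  rw [norm_smul, norm_smul, Real.norm_of_nonneg h2.le, Real.norm_of_nonneg hp.le]

lemma symbol_contDiff (φ : LPGenerator d) (k : ℤ) : ContDiff ℝ ∞ (symbol φ k) := by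
  unfold symbol
  exact φ.contDiff.comp (by fun_prop)

lemma symbol_eq_zero_of_le (φ : LPGenerator d) (k : ℤ) {ζ : Space d}
    (h : 2 * Real.pi * ‖ζ‖ ≤ 3 / 4 * (2 : ℝ) ^ k) : symbol φ k ζ = 0 := by
  apply toFun_eq_zero_of_le
  rw [norm_arg, zpow_neg, inv_mul_le_iff₀ (by positivity)]
  linarith

lemma symbol_eq_zero_of_ge (φ : LPGenerator d) (k : ℤ) {ζ : Space d}
    (h : 7 / 4 * (2 : ℝ) ^ k ≤ 2 * Real.pi * ‖ζ‖) : symbol φ k ζ = 0 := by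
  apply toFun_eq_zero_of_ge
  rw [norm_arg, zpow_neg, le_inv_mul_iff₀ (by positivity)]
  linarith

lemma hasCompactSupport_of_norm_ge {f : Space d → ℂ} (R : ℝ)
    (h : ∀ ζ : Space d, R ≤ 2 * Real.pi * ‖ζ‖ → f ζ = 0) : HasCompactSupport f := by
  refine HasCompactSupport.intro (isCompact_closedBall (0 : Space d) (R / (2 * Real.pi))) ?_
  intro ζ hζ
  apply h
  rw [mem_closedBall_zero_iff, not_le, div_lt_iff₀ (by positivity)] at hζ
  linarith

lemma symbol_hasCompactSupport (φ : LPGenerator d) (k : ℤ) : HasCompactSupport (symbol φ k) :=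
  hasCompactSupport_of_norm_ge _ fun _ h => symbol_eq_zero_of_ge φ k h

lemma inhomSymbol_zero_eq (φ : LPGenerator d) {ζ : Space d} (h : 2 * Real.pi * ‖ζ‖ < 3) :
    inhomSymbol φ 0 ζ = 1 - symbol φ 1 ζ := by
  have : ∑' j : ℕ, symbol φ (j + 1 : ℕ) ζ = symbol φ (0 + 1 : ℕ) ζ := by
    refine tsum_eq_single 0 fun j hj => symbol_eq_zero_of_le φ _ ?_
    have h4 : (2 : ℝ) ^ 2 ≤ (2 : ℝ) ^ (j + 1) :=
      pow_le_pow_right₀ (by norm_num) (by omega)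
    rw [zpow_natCast]
    linarith
  simp only [inhomSymbol, if_true, this]
  norm_num

lemma inhomSymbol_zero_eq_zero (φ : LPGenerator d) {ζ : Space d}
    (h : 7 / 4 ≤ 2 * Real.pi * ‖ζ‖) : inhomSymbol φ 0 ζ = 0 := by
  have hζ : (2 * Real.pi) • ζ ≠ 0 := by
    intro h0
    have h1 : ‖(2 * Real.pi) • ζ‖ = 2 * Real.pi * ‖ζ‖ := by
      rw [norm_smul, Real.norm_of_nonneg (by positivity)]
    rw [h0, norm_zero] at h1
    linarith
  have hs : HasSum (fun k : ℤ => symbol φ k ζ) 1 := φ.hasSum _ hζ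
  have hinj : Function.Injective (fun j : ℕ => ((j + 1 : ℕ) : ℤ)) := by
    intro a b hab
    simpa using hab
  have hs' : HasSum (fun j : ℕ => symbol φ (j + 1 : ℕ) ζ) 1 := by
    refine (hinj.hasSum_iff ?_).mpr hs
    intro k hk
    have hk0 : k ≤ 0 := by
      by_contra hpos
      exact hk ⟨(k - 1).toNat, by simp only; omega⟩
    refine symbol_eq_zero_of_ge φ k ?_
    have : (2 : ℝ) ^ k ≤ 1 := zpow_le_one_of_nonpos₀ (by norm_num) hk0
    linarith
  simp only [inhomSymbol, if_true, hs'.tsum_eq, sub_self]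

lemma inhomSymbol_contDiff (φ : LPGenerator d) (k : ℕ) : ContDiff ℝ ∞ (inhomSymbol φ k) := by
  rcases Nat.eq_zero_or_pos k with rfl | hk
  · rw [contDiff_iff_contDiffAt]
    intro ζ
    have hc : Continuous fun ζ : Space d => 2 * Real.pi * ‖ζ‖ := by fun_prop
    rcases lt_or_ge (2 * Real.pi * ‖ζ‖) 3 with h | h
    · have hev : inhomSymbol φ 0 =ᶠ[nhds ζ] fun ζ => 1 - symbol φ 1 ζ :=
        Filter.eventually_of_mem ((isOpen_lt hc continuous_const).mem_nhds h)
          fun x hx => inhomSymbol_zero_eq φ hx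
      exact (contDiffAt_const.sub (symbol_contDiff φ 1).contDiffAt).congr_of_eventuallyEq hev
    · have hmem : {ζ : Space d | 7 / 4 < 2 * Real.pi * ‖ζ‖} ∈ nhds ζ :=
        (isOpen_lt continuous_const hc).mem_nhds (by simp only [Set.mem_ofPred_eq]; linarith)
      have hev : inhomSymbol φ 0 =ᶠ[nhds ζ] fun _ => 0 :=
        Filter.eventually_of_mem hmem fun x hx => inhomSymbol_zero_eq_zero φ (le_of_lt hx)
      exact contDiffAt_const.congr_of_eventuallyEq hev
  · have : inhomSymbol φ k = symbol φ k := by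
      funext ζ
      simp [inhomSymbol, hk.ne']
    rw [this]
    exact symbol_contDiff φ k

lemma inhomSymbol_hasCompactSupport (φ : LPGenerator d) (k : ℕ) :
    HasCompactSupport (inhomSymbol φ k) := by
  rcases Nat.eq_zero_or_pos k with rfl | hk
  · exact hasCompactSupport_of_norm_ge _ fun _ h => inhomSymbol_zero_eq_zero φ h
  · have : inhomSymbol φ k = symbol φ k := by
      funext ζ
      simp [inhomSymbol, hk.ne']
    rw [this]
    exact symbol_hasCompactSupport φ k

/-! ### Kernels of Fourier multipliers -/

/-- The function `ζ ↦ m(ζ) e^{2πi⟨x,ζ⟩}` as a Schwartz function, for `m ∈ C_c^∞`. -/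
def modulated (m : Space d → ℂ) (h₁ : HasCompactSupport m) (h₂ : ContDiff ℝ ∞ m) (x : Space d) :
    𝓢(Space d, ℂ) :=
  HasCompactSupport.toSchwartzMap
    (f := fun ζ => Complex.exp (2 * Real.pi * Complex.I * (inner ℝ x ζ : ℝ)) * m ζ)
    h₁.mul_left
    (ContDiff.mul (Complex.contDiff_exp.comp (contDiff_const.mul
      (Complex.ofRealCLM.contDiff.comp (contDiff_const.inner ℝ contDiff_id)))) h₂)

/-- The Schwartz function `y ↦ ∫ m(ζ) e^{2πi⟨x-y,ζ⟩} dζ = (𝓕⁻¹ m)(x - y)`. Pairing a distribution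
`f` with it gives the value at `x` of the function `m(D) f`: this is Fourier inversion for
`m · f̂`, which has compact support. -/
def kernel (m : Space d → ℂ) (h₁ : HasCompactSupport m) (h₂ : ContDiff ℝ ∞ m) (x : Space d) :
    𝓢(Space d, ℂ) :=
  𝓕 (modulated m h₁ h₂ x)

/-! ### The space `𝒮_∞` and its dual -/

/-- `𝒮_∞(ℝ^d)`: the Schwartz functions whose Fourier transforms vanish to infinite order at `0`.
It carries the topology inherited from the Schwartz space. -/
def SchwartzInfty (d : ℕ) : Submodule ℂ 𝓢(Space d, ℂ) where
  carrier := {ψ | ∀ n : ℕ, iteratedFDeriv ℝ n (𝓕 ψ : 𝓢(Space d, ℂ)) 0 = 0}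
  zero_mem' := by
    intro n
    have : ((𝓕 (0 : 𝓢(Space d, ℂ)) : 𝓢(Space d, ℂ)) : Space d → ℂ) = 0 := by
      rw [FourierTransform.fourier_zero]; rfl
    rw [this]
    simp
  add_mem' := by
    intro a b ha hb n
    have : ((𝓕 (a + b) : 𝓢(Space d, ℂ)) : Space d → ℂ)
        = (𝓕 a : 𝓢(Space d, ℂ)) + (𝓕 b : 𝓢(Space d, ℂ)) := by
      rw [FourierTransform.fourier_add]; rfl
    rw [this, iteratedFDeriv_add_apply ((𝓕 a : 𝓢(Space d, ℂ)).smooth n).contDiffAt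
      ((𝓕 b : 𝓢(Space d, ℂ)).smooth n).contDiffAt, ha n, hb n, add_zero]
  smul_mem' := by
    intro c a ha n
    have : ((𝓕 (c • a) : 𝓢(Space d, ℂ)) : Space d → ℂ)
        = c • ((𝓕 a : 𝓢(Space d, ℂ)) : Space d → ℂ) := by
      rw [FourierTransform.fourier_smul]; rfl
    rw [this, iteratedFDeriv_const_smul_apply ((𝓕 a : 𝓢(Space d, ℂ)).smooth n).contDiffAt,
      ha n, smul_zero]

/-- `𝒮_∞'(ℝ^d)`: the continuous linear functionals on `𝒮_∞(ℝ^d)`. -/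
abbrev SchwartzInftyDual (d : ℕ) : Type := SchwartzInfty d →L[ℂ] ℂ

lemma kernel_mem_schwartzInfty (φ : LPGenerator d) (k : ℤ) (x : Space d) :
    kernel (symbol φ k) (symbol_hasCompactSupport φ k) (symbol_contDiff φ k) x
      ∈ SchwartzInfty d := by
  set h := modulated (symbol φ k) (symbol_hasCompactSupport φ k) (symbol_contDiff φ k) x with hh
  intro n
  have hval : ∀ ξ : Space d, (𝓕 (𝓕 h) : 𝓢(Space d, ℂ)) ξ = h (-ξ) := by
    intro ξ
    have h1 : (𝓕⁻ (𝓕 h) : 𝓢(Space d, ℂ)) (-ξ) = h (-ξ) := by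
      rw [FourierTransform.fourierInv_fourier_eq]
    rw [← h1, SchwartzMap.fourierInv_coe, SchwartzMap.fourier_coe, Real.fourierInv_eq_fourier_neg,
      neg_neg]
  have hev : ((𝓕 (𝓕 h) : 𝓢(Space d, ℂ)) : Space d → ℂ) =ᶠ[nhds 0] fun _ => 0 := by
    have hc : Continuous fun ζ : Space d => 2 * Real.pi * ‖ζ‖ := by fun_prop
    have hmem : {ζ : Space d | 2 * Real.pi * ‖ζ‖ < 3 / 4 * (2 : ℝ) ^ k} ∈ nhds (0 : Space d) :=
      (isOpen_lt hc continuous_const).mem_nhds (by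
        simp only [Set.mem_ofPred_eq, norm_zero, mul_zero]; positivity)
    refine Filter.eventually_of_mem hmem fun ζ hζ => ?_
    rw [hval]
    change Complex.exp _ * symbol φ k (-ζ) = 0
    rw [symbol_eq_zero_of_le φ k (by rw [norm_neg]; exact le_of_lt hζ), mul_zero]
  change iteratedFDeriv ℝ n ((𝓕 (𝓕 h) : 𝓢(Space d, ℂ)) : Space d → ℂ) 0 = 0
  rw [(hev.iteratedFDeriv ℝ n).eq_of_nhds]
  simp

/-! ### Frequency localizations -/

/-- `L_k f (x)` for `f ∈ 𝒮_∞'` and `k ∈ ℤ`. -/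
def L (φ : LPGenerator d) (k : ℤ) (f : SchwartzInftyDual d) (x : Space d) : ℂ :=
  f ⟨kernel (symbol φ k) (symbol_hasCompactSupport φ k) (symbol_contDiff φ k) x,
    kernel_mem_schwartzInfty φ k x⟩

/-- The inhomogeneous localization of a tempered distribution `f`, at `x`, for `k = 0, 1, 2, …`. -/
def inhomL (φ : LPGenerator d) (k : ℕ) (f : 𝓢'(Space d, ℂ)) (x : Space d) : ℂ :=
  f (kernel (inhomSymbol φ k) (inhomSymbol_hasCompactSupport φ k) (inhomSymbol_contDiff φ k) x)

/-! ### Lorentz spaces -/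

/-- `[g]_{L^{p,r}(μ)} = (r ∫_0^∞ λ^r μ(|g| > λ)^{r/p} dλ/λ)^{1/r}`, and
`sup_{λ > 0} λ μ(|g| > λ)^{1/p}` for `r = ∞`. -/
def lorentzQuasinorm {Ω : Type*} [MeasurableSpace Ω] (g : Ω → ℂ) (p : ℝ) (r : ℝ≥0∞)
    (μ : Measure Ω) : ℝ≥0∞ :=
  if r = ⊤ then
    ⨆ (t : ℝ) (_ : 0 < t), ENNReal.ofReal t * μ {z | t < ‖g z‖} ^ (1 / p)
  else
    (r * ∫⁻ t in Ioi (0 : ℝ), ENNReal.ofReal t ^ r.toReal * μ {z | t < ‖g z‖} ^ (r.toReal / p)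
      / ENNReal.ofReal t) ^ (1 / r.toReal)

/-- Membership in the Lorentz space `L^{p,r}(Ω, μ)`. -/
def MemLorentz {Ω : Type*} [MeasurableSpace Ω] (g : Ω → ℂ) (p : ℝ) (r : ℝ≥0∞)
    (μ : Measure Ω) : Prop :=
  AEStronglyMeasurable g μ ∧ lorentzQuasinorm g p r μ < ⊤

/-- The measure `μ_γ(E) = ∑_{k ∈ ℤ} 2^{-kγ} |{x : (x,k) ∈ E}|` on `ℝ^d × ℤ`. -/
def muMeasure (d : ℕ) (γ : ℝ) : Measure (Space d × ℤ) :=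
  Measure.sum fun k : ℤ =>
    ENNReal.ofReal ((2 : ℝ) ^ (-(k : ℝ) * γ)) •
      (volume : Measure (Space d)).map fun x => (x, k)

/-- The measure `∑_{k ≥ 0} 2^{-kγ} |{x : (x,k) ∈ E}|` on `ℝ^d × ℕ`, where `0 ∈ ℕ`. -/
def inhomMuMeasure (d : ℕ) (γ : ℝ) : Measure (Space d × ℕ) :=
  Measure.sum fun k : ℕ =>
    ENNReal.ofReal ((2 : ℝ) ^ (-(k : ℝ) * γ)) •
      (volume : Measure (Space d)).map fun x => (x, k)

/-! ### The function spaces -/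

/-- `P^b f (x,k) = 2^{kb} L_k f(x)` on `ℝ^d × ℤ`. -/
def P (φ : LPGenerator d) (b : ℝ) (f : SchwartzInftyDual d) (z : Space d × ℤ) : ℂ :=
  (((2 : ℝ) ^ ((z.2 : ℝ) * b) : ℝ) : ℂ) * L φ z.2 f z.1

/-- The inhomogeneous counterpart of `P`, on `ℝ^d × ℕ`. -/
def inhomP (φ : LPGenerator d) (b : ℝ) (f : 𝓢'(Space d, ℂ)) (z : Space d × ℕ) : ℂ :=
  (((2 : ℝ) ^ ((z.2 : ℝ) * b) : ℝ) : ℂ) * inhomL φ z.2 f z.1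

/-- The homogeneous space `𝓑̇^s_p(γ,r)`. -/
def homBLorentz (φ : LPGenerator d) (s p γ : ℝ) (r : ℝ≥0∞) : Set (SchwartzInftyDual d) :=
  {f | MemLorentz (P φ (s + γ / p) f) p r (muMeasure d γ)}

/-- The inhomogeneous space `𝓑^s_p(γ,r)`. -/
def inhomBLorentz (φ : LPGenerator d) (s p γ : ℝ) (r : ℝ≥0∞) : Set 𝓢'(Space d, ℂ) :=
  {f | MemLorentz (inhomP φ (s + γ / p) f) p r (inhomMuMeasure d γ)}

/-- The `ℓ^r` norm of a family of extended nonnegative numbers. -/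
def ellNorm {ι : Type*} (a : ι → ℝ≥0∞) (r : ℝ≥0∞) : ℝ≥0∞ :=
  if r = ⊤ then ⨆ k, a k else (∑' k, a k ^ r.toReal) ^ (1 / r.toReal)

/-- The homogeneous Besov space `Ḃ^s_{p,r}`: `(∑_{k ∈ ℤ} ‖2^{ks} L_k f‖_p^r)^{1/r} < ∞`. -/
def homBesov (φ : LPGenerator d) (s p : ℝ) (r : ℝ≥0∞) : Set (SchwartzInftyDual d) :=
  {f | ellNorm (fun k : ℤ => eLpNorm
    (fun x => (((2 : ℝ) ^ ((k : ℝ) * s) : ℝ) : ℂ) * L φ k f x) (ENNReal.ofReal p) volume) r < ⊤}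

/-- The inhomogeneous Besov space `B^s_{p,r}`. -/
def inhomBesov (φ : LPGenerator d) (s p : ℝ) (r : ℝ≥0∞) : Set 𝓢'(Space d, ℂ) :=
  {f | ellNorm (fun k : ℕ => eLpNorm
    (fun x => (((2 : ℝ) ^ ((k : ℝ) * s) : ℝ) : ℂ) * inhomL φ k f x) (ENNReal.ofReal p) volume) r
      < ⊤}

end BesovLorentz

end

/-! The counterexample is a lacunary sum of modulated bumps, one for each frequency `2^(n+1)`, with
amplitude `c n` and width `R n ≥ 1`. Each bump sits in frequency where the symbol of index `n + 1`
is one and all the others vanish, so the Littlewood-Paley pieces are exactly the bumps. In the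
`β`-space, layer `n + 1` has height `U β n = 2^((n+1)(β-γ)/p) V n`, while the `p`-th power of its
`L^p(μ_β)` norm is a fixed multiple of `A n`, whatever `β` is: the weight `2^(-kβ)` cancels the
factor `2^(kβ/p)`.

Take `A n = (n+1)^(-κ)` with `κ < 1`, and `κ > p/r` when `r` is finite. Then `A` lies in `ℓ^(r/p)`
but is not summable, and the Besov condition holds at once. What distinguishes the Lorentz spaces is
how the heights are arranged. Let `V n = 2^(-σ C N)`, where `N` is the largest power of two not
exceeding `n + 1`.

For `β = γ` the heights are constant on dyadic blocks of indices. Pieces of equal height add their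
measures, and the block sums of `A` are unbounded, so weak `L^p` fails
(`lorentzQuasinorm_top_eq_top`). For `|β - γ| = pσ` the heights become `2^(-σ j)` with `j = C N ±
(n+1)`, and these integers are pairwise distinct (`injective_mul_dyadicFloor_add`). Pieces at such
separated heights hardly interact, and the `L^{p,r}` quasinorm is controlled by the `ℓ^r` norm of
their `L^p` norms (`lorentzQuasinorm_lt_top`). -/

namespace BesovLorentz

/-! ### Frequency annuli seen by a single symbol -/

/-- The closed frequency annulus around the sphere of radius `2^(n+1)`, on which the symbol of
`L_{n+1}` is equal to one and all other symbols vanish. -/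
def freqAnnulus (d n : ℕ) : Set (Space d) :=
  {ζ | 7 / 8 * (2 : ℝ) ^ (n + 1) ≤ 2 * Real.pi * ‖ζ‖ ∧
    2 * Real.pi * ‖ζ‖ ≤ 9 / 8 * (2 : ℝ) ^ (n + 1)}

lemma symbol_eq_one_of_mem {d : ℕ} (φ : LPGenerator d) {n : ℕ} {ζ : Space d}
    (hζ : ζ ∈ freqAnnulus d n) : symbol φ ((n : ℤ) + 1) ζ = 1 := by
  have hpow : (2 : ℝ) ^ ((n : ℤ) + 1) = 2 ^ (n + 1) := by
    exact_mod_cast zpow_natCast (2 : ℝ) (n + 1)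
  have h2 : (0 : ℝ) < 2 ^ (n + 1) := by positivity
  apply φ.eq_one
  · rw [norm_arg, zpow_neg, hpow, le_inv_mul_iff₀ h2]
    linarith [hζ.1]
  · rw [norm_arg, zpow_neg, hpow, inv_mul_le_iff₀ h2]
    linarith [hζ.2]

lemma symbol_eq_zero_of_mem {d : ℕ} (φ : LPGenerator d) {n : ℕ} {k : ℤ} (hk : k ≠ n + 1)
    {ζ : Space d} (hζ : ζ ∈ freqAnnulus d n) : symbol φ k ζ = 0 := by
  have hpow : (2 : ℝ) ^ ((n : ℤ) + 1) = 2 ^ (n + 1) := by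
    exact_mod_cast zpow_natCast (2 : ℝ) (n + 1)
  rcases lt_or_gt_of_ne hk with h | h
  · apply symbol_eq_zero_of_ge
    have h1 : (2 : ℝ) ^ (k + 1) ≤ 2 ^ ((n : ℤ) + 1) := zpow_le_zpow_right₀ (by norm_num) (by omega)
    rw [zpow_add₀ (by norm_num), zpow_one, hpow] at h1
    linarith [hζ.1]
  · apply symbol_eq_zero_of_le
    have h1 : (2 : ℝ) ^ ((n : ℤ) + 1 + 1) ≤ 2 ^ k := zpow_le_zpow_right₀ (by norm_num) (by omega)
    rw [zpow_add₀ (by norm_num), zpow_one, hpow] at h1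
    have h2 : (0 : ℝ) < 2 ^ (n + 1) := by positivity
    linarith [hζ.2]

lemma inhomSymbol_succ {d : ℕ} (φ : LPGenerator d) (n : ℕ) :
    inhomSymbol φ (n + 1) = symbol φ ((n : ℤ) + 1) := by
  funext ζ
  simp [inhomSymbol]

lemma inhomSymbol_zero_eq_zero_of_mem {d : ℕ} (φ : LPGenerator d) {n : ℕ} {ζ : Space d}
    (hζ : ζ ∈ freqAnnulus d n) : inhomSymbol φ 0 ζ = 0 := by
  apply inhomSymbol_zero_eq_zero
  have h1 : (2 : ℝ) ^ 1 ≤ 2 ^ (n + 1) := pow_le_pow_right₀ (by norm_num) (by omega)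
  linarith [hζ.1]

/-- The frequency `2^(n+1)` in the direction `e`. -/
noncomputable def centerFreq {d : ℕ} (e : Space d) (n : ℕ) : Space d :=
  ((2 : ℝ) ^ (n + 1) / (2 * Real.pi)) • e

/-- The annulus leaves a margin of `1/8 * 2^(n+1) ≥ 1/8` on both sides of the central sphere. A
perturbation of size `1/8` stays inside after division by `R ≥ 1`; this is why bumps must have width
at least one. -/
lemma centerFreq_add_mem {d : ℕ} {e : Space d} (he : ‖e‖ = 1) (n : ℕ) {R : ℝ} (hR : 1 ≤ R)
    {η : Space d} (hη : 2 * Real.pi * ‖η‖ ≤ 1 / 8) :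
    centerFreq e n + R⁻¹ • η ∈ freqAnnulus d n := by
  have hpi : 0 < 2 * Real.pi := by positivity
  have h2 : (1 : ℝ) ≤ 2 ^ (n + 1) := one_le_pow₀ (by norm_num)
  have hc : 2 * Real.pi * ‖centerFreq e n‖ = 2 ^ (n + 1) := by
    rw [centerFreq, norm_smul, he, Real.norm_of_nonneg (by positivity)]
    field_simp
  have hs : 2 * Real.pi * ‖R⁻¹ • η‖ ≤ 1 / 8 := by
    have : ‖R⁻¹ • η‖ ≤ ‖η‖ := by
      rw [norm_smul, Real.norm_of_nonneg (by positivity)]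
      exact mul_le_of_le_one_left (norm_nonneg _) (inv_le_one_of_one_le₀ hR)
    nlinarith
  have h3 := norm_add_le (centerFreq e n) (R⁻¹ • η)
  have h4 := norm_sub_norm_le (centerFreq e n) (-(R⁻¹ • η))
  rw [sub_neg_eq_add, norm_neg] at h4
  constructor <;> nlinarith

/-! ### Distributions with prescribed Littlewood-Paley pieces -/

/-- The average of `χ` around the `n`-th frequency, at scale `R⁻¹` and with density `θ`. -/
noncomputable def freqAverage {d : ℕ} (e : Space d) (θ : 𝓢(Space d, ℂ)) (R : ℝ) (n : ℕ)
    (χ : Space d → ℂ) : ℂ :=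
  ∫ η, θ η * χ (centerFreq e n + R⁻¹ • η)

lemma integrable_freqAverage {d : ℕ} (e : Space d) (θ : 𝓢(Space d, ℂ)) (R : ℝ) (n : ℕ)
    (χ : 𝓢(Space d, ℂ)) :
    Integrable fun η => θ η * χ (centerFreq e n + R⁻¹ • η) := by
  refine θ.integrable.mul_bdd (c := SchwartzMap.seminorm ℂ 0 0 χ) ?_ ?_
  · exact (χ.continuous.comp (by fun_prop)).aestronglyMeasurable
  · exact Filter.Eventually.of_forall fun η => SchwartzMap.norm_le_seminorm ℂ χ _

/-- Only values of `χ` on the annulus enter, where `8‖ζ‖ ≥ 2^(n+1)`, so the rapid decay of `χ` gives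
any negative power of `2^(n+1)`. -/
lemma norm_freqAverage_le {d : ℕ} {e : Space d} (he : ‖e‖ = 1) {θ : 𝓢(Space d, ℂ)}
    (hθ : ∀ η, 1 / 8 < 2 * Real.pi * ‖η‖ → θ η = 0) {R : ℝ} (hR : 1 ≤ R) (n B : ℕ)
    (χ : 𝓢(Space d, ℂ)) :
    ‖freqAverage e θ R n χ‖ ≤
      (∫ η, ‖θ η‖) * (8 ^ B * SchwartzMap.seminorm ℂ B 0 χ) * (((2 : ℝ) ^ (n + 1)) ^ B)⁻¹ := by
  have hb : ∀ η, ‖θ η * χ (centerFreq e n + R⁻¹ • η)‖ ≤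
      ‖θ η‖ * (8 ^ B * SchwartzMap.seminorm ℂ B 0 χ * (((2 : ℝ) ^ (n + 1)) ^ B)⁻¹) := by
    intro η
    rw [norm_mul]
    rcases lt_or_ge (1 / 8) (2 * Real.pi * ‖η‖) with h | h
    · simp [hθ η h]
    gcongr
    set ζ := centerFreq e n + R⁻¹ • η with hζ
    have h1 : 7 / 8 * (2 : ℝ) ^ (n + 1) ≤ 2 * Real.pi * ‖ζ‖ := (centerFreq_add_mem he n hR h).1
    have h2 : (2 : ℝ) ^ (n + 1) ≤ 8 * ‖ζ‖ := by
      have := Real.pi_lt_d2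
      nlinarith [norm_nonneg ζ]
    have h3 := SchwartzMap.norm_pow_mul_le_seminorm ℂ χ B ζ
    rw [← div_eq_mul_inv, le_div_iff₀ (by positivity)]
    calc ‖χ ζ‖ * ((2 : ℝ) ^ (n + 1)) ^ B ≤ ‖χ ζ‖ * (8 * ‖ζ‖) ^ B := by gcongr
      _ = 8 ^ B * (‖ζ‖ ^ B * ‖χ ζ‖) := by rw [mul_pow]; ring
      _ ≤ _ := by gcongr
  calc ‖freqAverage e θ R n χ‖
      ≤ ∫ η, ‖θ η‖ * (8 ^ B * SchwartzMap.seminorm ℂ B 0 χ * (((2 : ℝ) ^ (n + 1)) ^ B)⁻¹) :=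
        norm_integral_le_of_norm_le (θ.integrable.norm.mul_const _) (Filter.Eventually.of_forall hb)
    _ = _ := by rw [integral_mul_const]; ring

/-- Coefficients of polynomial growth in the frequency are harmless. One power of decay beyond `B`
leaves a geometric series, so a single Schwartz seminorm gives both convergence and continuity. -/
lemma exists_lacunary_functional {d : ℕ} {e : Space d} (he : ‖e‖ = 1) {θ : 𝓢(Space d, ℂ)}
    (hθ : ∀ η, 1 / 8 < 2 * Real.pi * ‖η‖ → θ η = 0) {c R : ℕ → ℝ} (hR : ∀ n, 1 ≤ R n) {B : ℕ}
    (hc : ∀ n, |c n| ≤ ((2 : ℝ) ^ (n + 1)) ^ B) :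
    ∃ S : 𝓢(Space d, ℂ) →L[ℂ] ℂ, ∀ χ, S χ = ∑' n, (c n : ℂ) * freqAverage e θ (R n) n χ := by
  have hgeom : HasSum (fun n : ℕ => ((2 : ℝ) ^ (n + 1))⁻¹) 1 := by
    convert hasSum_geometric_two' (1 : ℝ) using 1
    funext n
    rw [pow_succ]
    field_simp
  have hb : ∀ (χ : 𝓢(Space d, ℂ)) (n : ℕ), ‖(c n : ℂ) * freqAverage e θ (R n) n χ‖ ≤
      (∫ η, ‖θ η‖) * (8 ^ (B + 1) * SchwartzMap.seminorm ℂ (B + 1) 0 χ) *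
        ((2 : ℝ) ^ (n + 1))⁻¹ := by
    intro χ n
    rw [norm_mul, Complex.norm_real, Real.norm_eq_abs]
    have h0 : 0 ≤ ∫ η, ‖θ η‖ := integral_nonneg fun _ => norm_nonneg _
    have h1 : 0 ≤ SchwartzMap.seminorm ℂ (B + 1) 0 χ := apply_nonneg _ _
    calc |c n| * ‖freqAverage e θ (R n) n χ‖
        ≤ ((2 : ℝ) ^ (n + 1)) ^ B * ((∫ η, ‖θ η‖) *
          (8 ^ (B + 1) * SchwartzMap.seminorm ℂ (B + 1) 0 χ) *
            (((2 : ℝ) ^ (n + 1)) ^ (B + 1))⁻¹) := by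
          gcongr
          · exact hc n
          · exact norm_freqAverage_le he hθ (hR n) n (B + 1) χ
      _ = _ := by
          rw [pow_succ ((2 : ℝ) ^ (n + 1)) B, mul_inv]
          field_simp
  have hsum : ∀ χ : 𝓢(Space d, ℂ),
      Summable fun n => (c n : ℂ) * freqAverage e θ (R n) n χ := fun χ =>
    Summable.of_norm_bounded (hgeom.summable.mul_left _) (hb χ)
  refine ⟨SchwartzMap.mkCLMtoNormedSpace
    (fun χ : 𝓢(Space d, ℂ) => ∑' n, (c n : ℂ) * freqAverage e θ (R n) n χ) ?_ ?_ ?_, fun χ => rfl⟩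
  · intro f g
    rw [← (hsum f).tsum_add (hsum g)]
    congr 1
    funext n
    rw [← mul_add, freqAverage, freqAverage, freqAverage,
      ← integral_add (integrable_freqAverage e θ _ n f) (integrable_freqAverage e θ _ n g)]
    simp only [add_apply, mul_add]
  · intro a f
    simp only [RingHom.id_apply, smul_eq_mul]
    rw [← tsum_mul_left]
    congr 1
    funext n
    rw [mul_left_comm]
    congr 1
    rw [freqAverage, freqAverage, ← integral_const_mul]
    congr 1
    funext η
    simp only [smul_apply, smul_eq_mul]
    ring
  · refine ⟨{(B + 1, 0)}, (∫ η, ‖θ η‖) * 8 ^ (B + 1), by positivity, fun f => ?_⟩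
    have := tsum_of_norm_bounded (hgeom.mul_left _) (hb f)
    simpa [schwartzSeminormFamily, mul_assoc] using this

lemma fourierInv_kernel {d : ℕ} (m : Space d → ℂ) (h₁ : HasCompactSupport m) (h₂ : ContDiff ℝ ∞ m)
    (x : Space d) : 𝓕⁻ (kernel m h₁ h₂ x) = modulated m h₁ h₂ x := by
  rw [kernel, FourierTransform.fourierInv_fourier_eq]

lemma freqAverage_modulated_eq_zero {d : ℕ} {e : Space d} (he : ‖e‖ = 1) {θ : 𝓢(Space d, ℂ)}
    (hθ : ∀ η, 1 / 8 < 2 * Real.pi * ‖η‖ → θ η = 0) {R : ℝ} (hR : 1 ≤ R) {n : ℕ}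
    {m : Space d → ℂ} (h₁ : HasCompactSupport m) (h₂ : ContDiff ℝ ∞ m) (x : Space d)
    (hm : ∀ ζ ∈ freqAnnulus d n, m ζ = 0) :
    freqAverage e θ R n (modulated m h₁ h₂ x) = 0 := by
  refine integral_eq_zero_of_ae (Filter.Eventually.of_forall fun η => ?_)
  rcases lt_or_ge (1 / 8) (2 * Real.pi * ‖η‖) with h | h
  · simp [hθ η h]
  · change _ * (_ * m (centerFreq e n + R⁻¹ • η)) = 0
    rw [hm _ (centerFreq_add_mem he n hR h), mul_zero, mul_zero]

/-- On the support of `θ` the multiplier is one, so only the character remains. Its value at the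
center factors out, and the rest is the inverse Fourier integral of `θ` at `R⁻¹ • x`. -/
lemma freqAverage_modulated_eq {d : ℕ} {e : Space d} (he : ‖e‖ = 1) {θ : 𝓢(Space d, ℂ)}
    (hθ : ∀ η, 1 / 8 < 2 * Real.pi * ‖η‖ → θ η = 0) {R : ℝ} (hR : 1 ≤ R) {n : ℕ}
    {m : Space d → ℂ} (h₁ : HasCompactSupport m) (h₂ : ContDiff ℝ ∞ m) (x : Space d)
    (hm : ∀ ζ ∈ freqAnnulus d n, m ζ = 1) :
    freqAverage e θ R n (modulated m h₁ h₂ x) =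
      Complex.exp (2 * Real.pi * Complex.I * (inner ℝ x (centerFreq e n) : ℝ)) *
        (𝓕⁻ θ : 𝓢(Space d, ℂ)) (R⁻¹ • x) := by
  rw [SchwartzMap.fourierInv_coe, Real.fourierInv_eq', ← integral_const_mul, freqAverage]
  congr 1
  funext η
  rcases lt_or_ge (1 / 8) (2 * Real.pi * ‖η‖) with h | h
  · simp [hθ η h]
  change _ * (Complex.exp _ * m (centerFreq e n + R⁻¹ • η)) = _
  rw [hm _ (centerFreq_add_mem he n hR h), mul_one, smul_eq_mul, ← mul_assoc, ← Complex.exp_add,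
    mul_comm]
  congr 2
  rw [inner_add_right, inner_smul_right, inner_smul_right, real_inner_comm x η]
  push_cast
  ring

/-- A tempered distribution whose Littlewood-Paley pieces of index `n + 1 ≥ 1` are modulated
dilates of `𝓕⁻ θ`, and whose other pieces vanish. -/
theorem exists_lacunary_distribution {d : ℕ} {e : Space d} (he : ‖e‖ = 1) {θ : 𝓢(Space d, ℂ)}
    (hθ : ∀ η, 1 / 8 < 2 * Real.pi * ‖η‖ → θ η = 0) {c R : ℕ → ℝ} (hR : ∀ n, 1 ≤ R n) {B : ℕ}
    (hc : ∀ n, |c n| ≤ ((2 : ℝ) ^ (n + 1)) ^ B) (φ : LPGenerator d) :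
    ∃ (F : SchwartzInftyDual d) (f : 𝓢'(Space d, ℂ)),
      (∀ (n : ℕ) x, L φ ((n : ℤ) + 1) F x = c n *
        (Complex.exp (2 * Real.pi * Complex.I * (inner ℝ x (centerFreq e n) : ℝ)) *
          (𝓕⁻ θ : 𝓢(Space d, ℂ)) ((R n)⁻¹ • x))) ∧
      (∀ k x, (∀ n : ℕ, k ≠ (n : ℤ) + 1) → L φ k F x = 0) ∧
      (∀ n x, inhomL φ (n + 1) f x = c n *
        (Complex.exp (2 * Real.pi * Complex.I * (inner ℝ x (centerFreq e n) : ℝ)) *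
          (𝓕⁻ θ : 𝓢(Space d, ℂ)) ((R n)⁻¹ • x))) ∧
      (∀ x, inhomL φ 0 f x = 0) := by
  obtain ⟨S, hS⟩ := exists_lacunary_functional he hθ hR hc
  -- `S` acts on the frequency side. Kernels are Fourier transforms of modulated symbols, so
  -- composing with `𝓕⁻` makes `T` pair `S` with the modulated symbols themselves.
  set T : 𝓢(Space d, ℂ) →L[ℂ] ℂ :=
    S ∘L (FourierTransform.fourierInvCLM ℂ 𝓢(Space d, ℂ)) with hT
  have hker : ∀ (m : Space d → ℂ) (h₁ : HasCompactSupport m) (h₂ : ContDiff ℝ ∞ m) (x : Space d),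
      T (kernel m h₁ h₂ x) = ∑' n, (c n : ℂ) * freqAverage e θ (R n) n (modulated m h₁ h₂ x) := by
    intro m h₁ h₂ x
    rw [hT, ContinuousLinearMap.comp_apply, FourierTransform.fourierInvCLM_apply,
      fourierInv_kernel, hS]
  have hzero : ∀ (m : Space d → ℂ) (h₁ : HasCompactSupport m) (h₂ : ContDiff ℝ ∞ m) (x : Space d),
      (∀ n, ∀ ζ ∈ freqAnnulus d n, m ζ = 0) → T (kernel m h₁ h₂ x) = 0 := by
    intro m h₁ h₂ x hm
    rw [hker]
    simp [fun n => freqAverage_modulated_eq_zero he hθ (hR n) h₁ h₂ x (hm n)]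
  have hone : ∀ (m : Space d → ℂ) (h₁ : HasCompactSupport m) (h₂ : ContDiff ℝ ∞ m) (n : ℕ),
      m = symbol φ ((n : ℤ) + 1) → ∀ x, T (kernel m h₁ h₂ x) = c n *
        (Complex.exp (2 * Real.pi * Complex.I * (inner ℝ x (centerFreq e n) : ℝ)) *
          (𝓕⁻ θ : 𝓢(Space d, ℂ)) ((R n)⁻¹ • x)) := by
    rintro m h₁ h₂ n rfl x
    rw [hker, tsum_eq_single n, freqAverage_modulated_eq he hθ (hR n) h₁ h₂ x
      fun ζ hζ => symbol_eq_one_of_mem φ hζ]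
    intro j hj
    rw [freqAverage_modulated_eq_zero he hθ (hR j) h₁ h₂ x
      fun ζ hζ => symbol_eq_zero_of_mem φ (by omega) hζ, mul_zero]
  have hL : ∀ k x, L φ k (T ∘L (SchwartzInfty d).subtypeL) x =
      T (kernel (symbol φ k) (symbol_hasCompactSupport φ k) (symbol_contDiff φ k) x) :=
    fun k x => rfl
  have hinhomL : ∀ k x, inhomL φ k (ContinuousLinearMap.toPointwiseConvergenceCLM _ _ _ _ T) x =
      T (kernel (inhomSymbol φ k) (inhomSymbol_hasCompactSupport φ k)
        (inhomSymbol_contDiff φ k) x) :=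
    fun k x => rfl
  refine ⟨T ∘L (SchwartzInfty d).subtypeL, ContinuousLinearMap.toPointwiseConvergenceCLM _ _ _ _ T,
    fun n x => ?_, fun k x hk => ?_, fun n x => ?_, fun x => ?_⟩
  · rw [hL]
    exact hone _ _ _ n rfl x
  · rw [hL]
    exact hzero _ _ _ x fun n ζ hζ => symbol_eq_zero_of_mem φ (hk n) hζ
  · rw [hinhomL]
    exact hone _ _ _ n (inhomSymbol_succ φ n) x
  · rw [hinhomL]
    exact hzero _ _ _ x fun n ζ hζ => inhomSymbol_zero_eq_zero_of_mem φ hζ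

/-! ### Sums and integrals of `peak` over lacunary heights -/

/-- The function `t ↦ min t t⁻¹`. -/
noncomputable def peak (t : ℝ) : ℝ := min t t⁻¹

lemma measurable_peak : Measurable peak := measurable_id.min measurable_inv

/-- Since `dt/t` is invariant under dilation, the bound does not depend on `u`. The parts below and
above `u` contribute at most one each. -/
lemma lintegral_peak_div_le {u : ℝ} (hu : 0 < u) :
    ∫⁻ t in Ioi (0 : ℝ), ENNReal.ofReal (peak (t / u)) / ENNReal.ofReal t ≤ 2 := by
  have h1 : ∫⁻ t in Ioc (0 : ℝ) u, ENNReal.ofReal (peak (t / u)) / ENNReal.ofReal t ≤ 1 := by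
    calc ∫⁻ t in Ioc (0 : ℝ) u, ENNReal.ofReal (peak (t / u)) / ENNReal.ofReal t
        ≤ ∫⁻ _ in Ioc (0 : ℝ) u, ENNReal.ofReal u⁻¹ := by
          refine setLIntegral_mono measurable_const fun t ht => ?_
          rw [← ENNReal.ofReal_div_of_pos ht.1]
          apply ENNReal.ofReal_le_ofReal
          rw [div_le_iff₀ ht.1]
          exact (min_le_left _ _).trans_eq (by ring)
      _ = 1 := by
          rw [setLIntegral_const, Real.volume_Ioc, sub_zero, ← ENNReal.ofReal_mul (by positivity),
            inv_mul_cancel₀ hu.ne', ENNReal.ofReal_one]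
  have h2 : ∫⁻ t in Ioi u, ENNReal.ofReal (peak (t / u)) / ENNReal.ofReal t ≤ 1 := by
    have hint : IntegrableOn (fun t : ℝ => u * t ^ (-2 : ℝ)) (Ioi u) :=
      (integrableOn_Ioi_rpow_of_lt (by norm_num) hu).const_mul u
    calc ∫⁻ t in Ioi u, ENNReal.ofReal (peak (t / u)) / ENNReal.ofReal t
        ≤ ∫⁻ t in Ioi u, ENNReal.ofReal (u * t ^ (-2 : ℝ)) := by
          refine setLIntegral_mono (by fun_prop) fun t ht => ?_
          have ht0 : 0 < t := hu.trans ht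
          rw [← ENNReal.ofReal_div_of_pos ht0]
          apply ENNReal.ofReal_le_ofReal
          rw [div_le_iff₀ ht0]
          refine (min_le_right _ _).trans_eq ?_
          rw [Real.rpow_neg ht0.le, Real.rpow_two]
          field_simp
      _ = 1 := by
          rw [← ofReal_integral_eq_lintegral_ofReal hint, integral_const_mul,
            integral_Ioi_rpow_of_lt (by norm_num) hu]
          · have : (-2 : ℝ) + 1 = -1 := by norm_num
            rw [this, Real.rpow_neg_one]
            rw [show u * (-u⁻¹ / -1) = 1 by field_simp, ENNReal.ofReal_one]
          · filter_upwards [self_mem_ae_restrict measurableSet_Ioi] with t ht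
            have ht0 : 0 < t := hu.trans ht
            simp only [Pi.zero_apply]
            positivity
  rw [← Ioc_union_Ioi_eq_Ioi hu.le, lintegral_union measurableSet_Ioi (Ioc_disjoint_Ioi le_rfl)]
  exact (add_le_add h1 h2).trans_eq one_add_one_eq_two

/-- In the logarithmic variable `peak` decays exponentially on both sides. Rounding `τ` to an
integer costs the factor `2^σ` and leaves a shifted two-sided geometric sequence. -/
lemma peak_two_rpow_le {σ : ℝ} (hσ : 0 < σ) (τ : ℝ) (j : ℤ) :
    peak ((2 : ℝ) ^ (σ * (τ + j))) ≤ 2 ^ σ * (2 ^ (-σ)) ^ (⌊τ⌋ + j).natAbs := by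
  have h2 : ((2 : ℝ) ^ (-σ)) ^ (⌊τ⌋ + j).natAbs = 2 ^ (-σ * |((⌊τ⌋ + j : ℤ) : ℝ)|) := by
    rw [← Real.rpow_natCast, ← Real.rpow_mul (by norm_num), Nat.cast_natAbs]
    push_cast
    rfl
  have hf1 := Int.floor_le τ
  have hf2 := Int.lt_floor_add_one τ
  rw [h2, ← Real.rpow_add (by norm_num), peak, ← Real.rpow_neg (by norm_num)]
  push_cast
  rcases abs_cases ((⌊τ⌋ : ℝ) + j) with ⟨h, -⟩ | ⟨h, -⟩
  · refine (min_le_right _ _).trans (Real.rpow_le_rpow_of_exponent_le (by norm_num) ?_)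
    rw [h]
    nlinarith
  · refine (min_le_left _ _).trans (Real.rpow_le_rpow_of_exponent_le (by norm_num) ?_)
    rw [h]
    nlinarith

/-- Distinct integer exponents make the sum a subsum of a shifted two-sided geometric series on `ℤ`.
Its total does not see the shift, hence the bound is uniform in `t` and in `j`. -/
lemma exists_tsum_peak_le {σ : ℝ} (hσ : 0 < σ) :
    ∃ B : ℝ≥0∞, B ≠ ⊤ ∧ ∀ (j : ℕ → ℤ), Function.Injective j → ∀ t : ℝ, 0 < t →
      ∑' n, ENNReal.ofReal (peak (t / 2 ^ (-σ * j n))) ≤ B := by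
  have hq0 : (0 : ℝ) ≤ 2 ^ (-σ) := by positivity
  have hq1 : (2 : ℝ) ^ (-σ) < 1 := Real.rpow_lt_one_of_one_lt_of_neg (by norm_num) (by linarith)
  have hs : Summable fun i : ℤ => (2 : ℝ) ^ σ * (2 ^ (-σ)) ^ i.natAbs := by
    refine Summable.mul_left _ (Summable.of_nat_of_neg ?_ ?_) <;>
    simpa using summable_geometric_of_lt_one hq0 hq1
  refine ⟨∑' i : ℤ, ENNReal.ofReal ((2 : ℝ) ^ σ * (2 ^ (-σ)) ^ i.natAbs), hs.tsum_ofReal_ne_top,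
    fun j hj t ht => ?_⟩
  set τ := Real.logb 2 t / σ with hτ
  have htτ : t = 2 ^ (σ * τ) := by
    rw [hτ, mul_div_cancel₀ _ hσ.ne', Real.rpow_logb (by norm_num) (by norm_num) ht]
  have hterm : ∀ i : ℤ, ENNReal.ofReal (peak (t / 2 ^ (-σ * i))) ≤
      ENNReal.ofReal ((2 : ℝ) ^ σ * (2 ^ (-σ)) ^ (⌊τ⌋ + i).natAbs) := by
    intro i
    apply ENNReal.ofReal_le_ofReal
    rw [htτ, ← Real.rpow_sub (by norm_num), show σ * τ - -σ * i = σ * (τ + i) by ring]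
    exact peak_two_rpow_le hσ τ i
  calc ∑' n, ENNReal.ofReal (peak (t / 2 ^ (-σ * j n)))
      ≤ ∑' n, ENNReal.ofReal ((2 : ℝ) ^ σ * (2 ^ (-σ)) ^ (⌊τ⌋ + j n).natAbs) :=
        ENNReal.tsum_le_tsum fun n => hterm (j n)
    _ ≤ _ := ENNReal.tsum_comp_le_tsum_of_injective (f := fun n => ⌊τ⌋ + j n)
        (fun a b hab => hj (add_left_cancel hab))
        fun i : ℤ => ENNReal.ofReal ((2 : ℝ) ^ σ * (2 ^ (-σ)) ^ i.natAbs)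

/-- Jensen's inequality for sums with unnormalized weights `b`. -/
lemma tsum_mul_rpow_le {q : ℝ} (hq : 1 < q) (a b : ℕ → ℝ≥0∞) :
    (∑' n, a n * b n) ^ q ≤ (∑' n, b n) ^ (q - 1) * ∑' n, a n ^ q * b n := by
  have hq0 : 0 < q := by linarith
  have hc := Real.HolderConjugate.conjExponent hq
  -- Hölder for counting measure, with the weight split as `b = b^(1/q) * b^(1/q')`.
  have h := ENNReal.lintegral_mul_le_Lp_mul_Lq (Measure.count (α := ℕ)) hc
    (f := fun n => a n * b n ^ (1 / q)) (g := fun n => b n ^ (1 / q.conjExponent))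
    (Measurable.of_discrete.aemeasurable) (Measurable.of_discrete.aemeasurable)
  simp only [lintegral_count, Pi.mul_apply] at h
  have h1 : ∀ n, a n * b n ^ (1 / q) * b n ^ (1 / q.conjExponent) = a n * b n := by
    intro n
    rw [mul_assoc, ← ENNReal.rpow_add_of_nonneg _ _ (by have := hc.pos; positivity)
      (by have := hc.symm.pos; positivity), one_div, one_div, hc.inv_add_inv_eq_one,
      ENNReal.rpow_one]
  have h2 : ∀ n, (a n * b n ^ (1 / q)) ^ q = a n ^ q * b n := by
    intro n
    rw [ENNReal.mul_rpow_of_nonneg _ _ hq0.le, ← ENNReal.rpow_mul, one_div_mul_cancel hq0.ne',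
      ENNReal.rpow_one]
  have h3 : ∀ n, (b n ^ (1 / q.conjExponent)) ^ q.conjExponent = b n := by
    intro n
    rw [← ENNReal.rpow_mul, one_div_mul_cancel hc.symm.pos.ne', ENNReal.rpow_one]
  simp only [h1, h2, h3] at h
  refine (ENNReal.rpow_le_rpow h hq0.le).trans_eq ?_
  rw [ENNReal.mul_rpow_of_nonneg _ _ hq0.le, ← ENNReal.rpow_mul, ← ENNReal.rpow_mul,
    one_div_mul_cancel hq0.ne', ENNReal.rpow_one, mul_comm]
  congr 2
  rw [Real.conjExponent]
  field_simp

/-! ### Lorentz quasinorms of superpositions -/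

/-- The distribution function `t ↦ ∑ Aₙ Uₙ^{-p} D(t / Uₙ)` of a superposition of pieces on disjoint
sets, with heights `Uₙ` and `p`-th powers of `L^p` norms proportional to `Aₙ`. -/
noncomputable def superposedDistribution (p : ℝ) (A U : ℕ → ℝ) (D : ℝ → ℝ≥0∞) (t : ℝ) : ℝ≥0∞ :=
  ∑' n, ENNReal.ofReal (A n * U n ^ (-p)) * D (t / U n)

lemma superposedDistribution_le {p K : ℝ} (hK : 0 ≤ K) {A U : ℕ → ℝ} {D : ℝ → ℝ≥0∞}
    (hA : ∀ n, 0 ≤ A n) (hU : ∀ n, 0 < U n)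
    (hD : ∀ t, 0 < t → D t ≤ ENNReal.ofReal (K * t ^ (-p) * peak t)) {t : ℝ} (ht : 0 < t) :
    superposedDistribution p A U D t ≤
      ENNReal.ofReal (K * t ^ (-p)) *
        ∑' n, ENNReal.ofReal (A n) * ENNReal.ofReal (peak (t / U n)) := by
  rw [superposedDistribution, ← ENNReal.tsum_mul_left]
  refine ENNReal.tsum_le_tsum fun n => ?_
  have hUn := hU n
  have hAn := hA n
  refine (mul_le_mul_right (hD _ (by positivity)) _).trans_eq ?_
  rw [← ENNReal.ofReal_mul (by positivity), ← ENNReal.ofReal_mul (by positivity),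
    ← ENNReal.ofReal_mul (by positivity)]
  congr 1
  rw [Real.div_rpow ht.le hUn.le]
  have : U n ^ (-p) ≠ 0 := (Real.rpow_pos_of_pos hUn _).ne'
  field_simp

/-- A superposition of pieces at lacunary heights `2^{-σ jₙ}` belongs to `L^{p,r}` if the `L^p`
norms of the pieces are in `ℓ^r`. -/
theorem lorentzQuasinorm_lt_top {Ω : Type*} [MeasurableSpace Ω] {μ : Measure Ω} {g : Ω → ℂ}
    {p σ K : ℝ} {r : ℝ≥0∞} (hp : 1 < p) (hpr : ENNReal.ofReal p < r) (hσ : 0 < σ) (hK : 0 ≤ K)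
    {A : ℕ → ℝ} {j : ℕ → ℤ} (hj : Function.Injective j) {D : ℝ → ℝ≥0∞}
    (hA : ∀ n, 0 ≤ A n) (hA1 : ∀ n, A n ≤ 1)
    (hAr : r ≠ ⊤ → Summable fun n => A n ^ (r.toReal / p))
    (hD : ∀ t, 0 < t → D t ≤ ENNReal.ofReal (K * t ^ (-p) * peak t))
    (hg : ∀ t, 0 < t → μ {z | t < ‖g z‖} =
      superposedDistribution p A (fun n => 2 ^ (-σ * j n)) D t) :
    lorentzQuasinorm g p r μ < ⊤ := by
  have hp0 : 0 < p := by linarith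
  obtain ⟨B, hB, hsum⟩ := exists_tsum_peak_le hσ
  have hF : ∀ t, 0 < t → μ {z | t < ‖g z‖} ≤ ENNReal.ofReal (K * t ^ (-p)) *
      ∑' n, ENNReal.ofReal (A n) * ENNReal.ofReal (peak (t / 2 ^ (-σ * j n))) := fun t ht =>
    (hg t ht).trans_le (superposedDistribution_le hK hA (fun n => by positivity) hD ht)
  by_cases hr : r = ⊤
  · rw [lorentzQuasinorm, if_pos hr]
    refine lt_of_le_of_lt (b := (ENNReal.ofReal K * B) ^ (1 / p)) ?_
      (ENNReal.rpow_lt_top_of_nonneg (by positivity) (ENNReal.mul_ne_top ENNReal.ofReal_ne_top hB))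
    refine iSup₂_le fun t ht => ?_
    have h1 : μ {z | t < ‖g z‖} ≤ ENNReal.ofReal (K * t ^ (-p)) * B := by
      refine (hF t ht).trans (mul_le_mul_right ((ENNReal.tsum_le_tsum fun n => ?_).trans
        (hsum j hj t ht)) _)
      exact mul_le_of_le_one_left zero_le (ENNReal.ofReal_le_one.2 (hA1 n))
    calc ENNReal.ofReal t * μ {z | t < ‖g z‖} ^ (1 / p)
        ≤ ENNReal.ofReal t * (ENNReal.ofReal (K * t ^ (-p)) * B) ^ (1 / p) := by gcongr
      _ = (ENNReal.ofReal (t ^ p) * (ENNReal.ofReal (K * t ^ (-p)) * B)) ^ (1 / p) := by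
          rw [ENNReal.mul_rpow_of_nonneg (ENNReal.ofReal (t ^ p)) _ (by positivity),
            ← ENNReal.ofReal_rpow_of_pos ht, ← ENNReal.rpow_mul, mul_one_div_cancel hp0.ne',
            ENNReal.rpow_one]
      _ = (ENNReal.ofReal K * B) ^ (1 / p) := by
          rw [← mul_assoc, ← ENNReal.ofReal_mul (by positivity), Real.rpow_neg ht.le]
          congr 3
          field_simp
  · have hr0 : p < r.toReal := (ENNReal.ofReal_lt_iff_lt_toReal hp0.le hr).1 hpr
    set ρ := r.toReal with hρ
    have hρ0 : 0 < ρ := by linarith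
    have hq : 1 < ρ / p := (one_lt_div hp0).2 hr0
    rw [lorentzQuasinorm, if_neg hr]
    refine ENNReal.rpow_lt_top_of_nonneg (by positivity) (ENNReal.mul_ne_top hr ?_)
    -- Jensen with the `peak` values as weights, of total mass at most `B`, moves the power `ρ / p`
    -- onto the `A n`. The factor `t ^ ρ` cancels `(t ^ (-p)) ^ (ρ / p)`, leaving `peak / t`, whose
    -- integral is at most `2` for each `n`.
    have hpt : ∀ t ∈ Ioi (0 : ℝ), ENNReal.ofReal t ^ ρ * μ {z | t < ‖g z‖} ^ (ρ / p) /
        ENNReal.ofReal t ≤ ENNReal.ofReal K ^ (ρ / p) * B ^ (ρ / p - 1) *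
          ∑' n, ENNReal.ofReal (A n) ^ (ρ / p) *
            (ENNReal.ofReal (peak (t / 2 ^ (-σ * j n))) / ENNReal.ofReal t) := by
      intro t ht
      have ht0 : 0 < t := ht
      have h1 : μ {z | t < ‖g z‖} ^ (ρ / p) ≤ ENNReal.ofReal (K * t ^ (-p)) ^ (ρ / p) *
          (B ^ (ρ / p - 1) * ∑' n, ENNReal.ofReal (A n) ^ (ρ / p) *
            ENNReal.ofReal (peak (t / 2 ^ (-σ * j n)))) := by
        refine (ENNReal.rpow_le_rpow (hF t ht) (by positivity)).trans ?_
        rw [ENNReal.mul_rpow_of_nonneg _ _ (by positivity)]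
        refine mul_le_mul_right ((tsum_mul_rpow_le hq _ _).trans ?_) _
        exact mul_le_mul_left (ENNReal.rpow_le_rpow (hsum j hj t ht) (by linarith)) _
      have h2 : ENNReal.ofReal t ^ ρ * ENNReal.ofReal (K * t ^ (-p)) ^ (ρ / p) =
          ENNReal.ofReal K ^ (ρ / p) := by
        have : ENNReal.ofReal t ^ ρ = (ENNReal.ofReal t ^ p) ^ (ρ / p) := by
          rw [← ENNReal.rpow_mul, mul_div_cancel₀ _ hp0.ne']
        rw [this, ← ENNReal.mul_rpow_of_nonneg _ _ (by positivity), ENNReal.ofReal_rpow_of_pos ht0,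
          ← ENNReal.ofReal_mul (by positivity), Real.rpow_neg ht0.le]
        congr 2
        field_simp
      simp only [div_eq_mul_inv _ (ENNReal.ofReal t), ← mul_assoc]
      rw [ENNReal.tsum_mul_right, ← mul_assoc, ← h2]
      refine mul_le_mul_left ((mul_le_mul_right h1 _).trans_eq ?_) _
      ring
    refine ((setLIntegral_mono' measurableSet_Ioi hpt).trans_lt ?_).ne
    have hm : ∀ n, Measurable fun t : ℝ => ENNReal.ofReal (A n) ^ (ρ / p) *
        (ENNReal.ofReal (peak (t / 2 ^ (-σ * j n))) / ENNReal.ofReal t) := fun n =>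
      ((measurable_peak.comp (measurable_id.div_const _)).ennreal_ofReal.div
        measurable_id.ennreal_ofReal).const_mul _
    rw [lintegral_const_mul _ (Measurable.tsum hm),
      lintegral_tsum fun n => (hm n).aemeasurable]
    refine ENNReal.mul_lt_top (ENNReal.mul_lt_top
      (ENNReal.rpow_lt_top_of_nonneg (by positivity) ENNReal.ofReal_ne_top)
      (ENNReal.rpow_lt_top_of_nonneg (by linarith) hB)) ?_
    calc ∑' n, ∫⁻ t in Ioi (0 : ℝ), ENNReal.ofReal (A n) ^ (ρ / p) *
          (ENNReal.ofReal (peak (t / 2 ^ (-σ * j n))) / ENNReal.ofReal t)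
        ≤ ∑' n, ENNReal.ofReal (A n ^ (ρ / p)) * 2 := by
          refine ENNReal.tsum_le_tsum fun n => ?_
          rw [lintegral_const_mul', ENNReal.ofReal_rpow_of_nonneg (hA n) (by positivity)]
          · gcongr
            exact lintegral_peak_div_le (by positivity)
          · exact ENNReal.rpow_ne_top_of_nonneg (by positivity) ENNReal.ofReal_ne_top
      _ < ⊤ := by
          rw [ENNReal.tsum_mul_right]
          exact ENNReal.mul_lt_top (hAr hr).tsum_ofReal_lt_top (by simp)

/-- A superposition of pieces, among which arbitrarily large total `p`-th powers of `L^p` norms are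
carried by pieces of equal height, is not in weak `L^p`. -/
theorem lorentzQuasinorm_top_eq_top {Ω : Type*} [MeasurableSpace Ω] {μ : Measure Ω} {g : Ω → ℂ}
    {p τ : ℝ} (hp : 0 < p) (hτ : 0 < τ) {A V : ℕ → ℝ} {D : ℝ → ℝ≥0∞} (hA : ∀ n, 0 ≤ A n)
    (hD : D τ ≠ 0)
    (hblock : ∀ M : ℝ, ∃ (s : Finset ℕ) (v : ℝ), 0 < v ∧ (∀ n ∈ s, V n = v) ∧ M ≤ ∑ n ∈ s, A n)
    (hg : ∀ t, 0 < t → μ {z | t < ‖g z‖} = superposedDistribution p A V D t) :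
    lorentzQuasinorm g p ⊤ μ = ⊤ := by
  rw [lorentzQuasinorm, if_pos rfl]
  set Q := ⨆ (t : ℝ) (_ : 0 < t), ENNReal.ofReal t * μ {z | t < ‖g z‖} ^ (1 / p) with hQ
  -- At level `τ * v` every piece of height `v` contributes its share `D τ`. The powers of `v`
  -- cancel, so only the total mass of the block remains.
  have hlow : ∀ M : ℝ, 0 ≤ M → ENNReal.ofReal M * (ENNReal.ofReal (τ ^ p) * D τ) ≤ Q ^ p := by
    intro M hM
    obtain ⟨s, v, hv, hs, hMs⟩ := hblock M
    have h1 : ENNReal.ofReal (v ^ (-p)) * (ENNReal.ofReal M * D τ) ≤ μ {z | τ * v < ‖g z‖} := by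
      rw [hg _ (by positivity), superposedDistribution]
      refine le_trans ?_ (ENNReal.sum_le_tsum s)
      calc ENNReal.ofReal (v ^ (-p)) * (ENNReal.ofReal M * D τ)
          ≤ ENNReal.ofReal (v ^ (-p)) * (ENNReal.ofReal (∑ n ∈ s, A n) * D τ) := by gcongr
        _ = ∑ n ∈ s, ENNReal.ofReal (v ^ (-p)) * (ENNReal.ofReal (A n) * D τ) := by
            rw [ENNReal.ofReal_sum_of_nonneg fun n _ => hA n, Finset.sum_mul, Finset.mul_sum]
        _ = _ := by
            refine Finset.sum_congr rfl fun n hn => ?_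
            rw [hs n hn, ENNReal.ofReal_mul (hA n), mul_div_cancel_right₀ _ hv.ne']
            ring
    have h2 : ENNReal.ofReal (τ * v) * μ {z | τ * v < ‖g z‖} ^ (1 / p) ≤ Q :=
      le_iSup₂_of_le (f := fun (t : ℝ) (_ : 0 < t) =>
        ENNReal.ofReal t * μ {z | t < ‖g z‖} ^ (1 / p)) (τ * v) (by positivity) le_rfl
    calc ENNReal.ofReal M * (ENNReal.ofReal (τ ^ p) * D τ)
        = ENNReal.ofReal ((τ * v) ^ p) *
            (ENNReal.ofReal (v ^ (-p)) * (ENNReal.ofReal M * D τ)) := by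
          have : (τ * v) ^ p * v ^ (-p) = τ ^ p := by
            rw [Real.mul_rpow hτ.le hv.le, Real.rpow_neg hv.le]
            field_simp
          rw [← this, ENNReal.ofReal_mul (by positivity)]
          ring
      _ ≤ ENNReal.ofReal ((τ * v) ^ p) * μ {z | τ * v < ‖g z‖} := by gcongr
      _ = (ENNReal.ofReal (τ * v) * μ {z | τ * v < ‖g z‖} ^ (1 / p)) ^ p := by
          rw [ENNReal.mul_rpow_of_nonneg _ _ hp.le, ENNReal.ofReal_rpow_of_pos (by positivity),
            ← ENNReal.rpow_mul, one_div_mul_cancel hp.ne', ENNReal.rpow_one]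
      _ ≤ Q ^ p := by gcongr
  by_contra hne
  have hQp : Q ^ p ≠ ⊤ := ENNReal.rpow_ne_top_of_nonneg hp.le hne
  set E := ENNReal.ofReal (τ ^ p) * D τ with hE
  have hE0 : E ≠ 0 := mul_ne_zero (by simpa using Real.rpow_pos_of_pos hτ p) hD
  have hdiv : Q ^ p / E ≠ ⊤ := ENNReal.div_ne_top hQp hE0
  -- A finite `Q` would bound all `M` by `Q ^ p / E`; this `M` exceeds that bound by one.
  have h := hlow ((Q ^ p / E).toReal + 1) (by positivity)
  have h1E : E ≠ ⊤ := by
    intro htop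
    have := hlow 1 zero_le_one
    rw [htop, ENNReal.ofReal_one, one_mul, top_le_iff] at this
    exact hQp this
  rw [← ENNReal.le_div_iff_mul_le (Or.inl hE0) (Or.inl h1E), ENNReal.ofReal_le_iff_le_toReal hdiv]
    at h
  linarith

/-! ### Distribution functions and dilates of a fixed profile -/

/-- The distribution function of a complex-valued function on `ℝ^d`. -/
noncomputable def distribution {d : ℕ} (Φ : Space d → ℂ) (t : ℝ) : ℝ≥0∞ := volume {x | t < ‖Φ x‖}

lemma volume_superlevel_dilate {d : ℕ} (Φ : Space d → ℂ) {h R : ℝ} (hh : 0 < h) (hR : 0 < R)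
    (t : ℝ) : volume {x : Space d | t < h * ‖Φ (R⁻¹ • x)‖} =
      ENNReal.ofReal (R ^ d) * distribution Φ (t / h) := by
  have hset : {x : Space d | t < h * ‖Φ (R⁻¹ • x)‖} = (R⁻¹ • ·) ⁻¹' {x | t / h < ‖Φ x‖} := by
    ext x
    simp only [mem_ofPred_eq, mem_preimage]
    rw [div_lt_iff₀ hh, mul_comm]
  rw [hset, Measure.addHaar_preimage_smul _ (by positivity), finrank_euclideanSpace_fin, distribution,
    inv_pow, inv_inv, abs_of_pos (by positivity)]

lemma eLpNorm_dilate {d : ℕ} {Φ : Space d → ℂ} (hΦ : Continuous Φ) {R p : ℝ} (hR : 0 < R)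
    (hp : 0 < p) : eLpNorm (fun x => Φ (R⁻¹ • x)) (ENNReal.ofReal p) volume =
      ENNReal.ofReal ((R ^ d) ^ (1 / p)) * eLpNorm Φ (ENNReal.ofReal p) volume := by
  have hmap : Measure.map (R⁻¹ • ·) (volume : Measure (Space d)) =
      ENNReal.ofReal (R ^ d) • volume := by
    rw [Measure.map_addHaar_smul _ (by positivity), finrank_euclideanSpace_fin, inv_pow, inv_inv,
      abs_of_pos (by positivity)]
  have h := eLpNorm_map_measure (p := ENNReal.ofReal p) (f := fun x : Space d => R⁻¹ • x)
    (μ := volume) hΦ.aestronglyMeasurable (by fun_prop)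
  rw [hmap, eLpNorm_smul_measure_of_ne_top ENNReal.ofReal_ne_top, one_div, ENNReal.toReal_inv,
    ENNReal.toReal_ofReal hp.le, ← one_div, smul_eq_mul,
    ENNReal.ofReal_rpow_of_nonneg (by positivity) (by positivity)] at h
  exact h.symm

lemma exists_distribution_le_rpow {d : ℕ} {Φ : Space d → ℂ} {q : ℝ} (hq : 0 < q)
    (hΦ : MemLp Φ (ENNReal.ofReal q) volume) :
    ∃ K : ℝ, 0 ≤ K ∧ ∀ t, 0 < t → distribution Φ t ≤ ENNReal.ofReal (K * t ^ (-q)) := by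
  have hq0 : ENNReal.ofReal q ≠ 0 := by simpa using hq
  set E := eLpNorm Φ (ENNReal.ofReal q) volume ^ q with hE
  have hEtop : E ≠ ⊤ :=
    ENNReal.rpow_ne_top_of_nonneg hq.le hΦ.eLpNorm_ne_top
  refine ⟨E.toReal, ENNReal.toReal_nonneg, fun t ht => ?_⟩
  have h := meas_ge_le_mul_pow_eLpNorm_enorm volume hq0 ENNReal.ofReal_ne_top
    hΦ.aestronglyMeasurable (ε := ENNReal.ofReal t) (by simpa using ht) (by simp)
  rw [ENNReal.toReal_ofReal hq.le, ENNReal.inv_rpow, ENNReal.ofReal_rpow_of_pos ht,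
    ← ENNReal.ofReal_inv_of_pos (by positivity), ← Real.rpow_neg ht.le] at h
  rw [mul_comm, ENNReal.ofReal_mul (by positivity), ENNReal.ofReal_toReal hEtop]
  refine le_trans (measure_mono fun x hx => ?_) h
  simp only [mem_ofPred_eq] at hx ⊢
  rw [← ofReal_norm]
  exact ENNReal.ofReal_le_ofReal hx.le

/-- Chebyshev's inequality with exponent `p - 1` for small `t` and `p + 1` for large `t` gains a
factor `t` or `t⁻¹` over the critical power `t^(-p)`. Positivity of `p - 1` uses `p > 1`. -/
lemma exists_distribution_le_peak {d : ℕ} (Φ : 𝓢(Space d, ℂ)) {p : ℝ} (hp : 1 < p) :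
    ∃ K : ℝ, 0 ≤ K ∧ ∀ t, 0 < t → distribution Φ t ≤ ENNReal.ofReal (K * t ^ (-p) * peak t) := by
  obtain ⟨K₁, h₁, hK₁⟩ := exists_distribution_le_rpow (q := p - 1) (by linarith)
    (Φ.memLp _ volume)
  obtain ⟨K₂, h₂, hK₂⟩ := exists_distribution_le_rpow (q := p + 1) (by linarith)
    (Φ.memLp _ volume)
  refine ⟨max K₁ K₂, by positivity, fun t ht => ?_⟩
  rcases le_total t t⁻¹ with h | h
  · refine (hK₁ t ht).trans (ENNReal.ofReal_le_ofReal ?_)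
    rw [peak, min_eq_left h, mul_assoc, ← Real.rpow_add_one ht.ne', show -p + 1 = -(p - 1) by ring]
    gcongr
    exact le_max_left _ _
  · refine (hK₂ t ht).trans (ENNReal.ofReal_le_ofReal ?_)
    rw [peak, min_eq_right h, mul_assoc, ← Real.rpow_neg_one, ← Real.rpow_add ht,
      show -p + -1 = -(p + 1) by ring]
    gcongr
    exact le_max_right _ _

lemma exists_distribution_ne_zero {d : ℕ} {Φ : Space d → ℂ} (hc : Continuous Φ) {x : Space d}
    (hx : Φ x ≠ 0) : ∃ τ : ℝ, 0 < τ ∧ distribution Φ τ ≠ 0 := by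
  have h : 0 < ‖Φ x‖ := norm_pos_iff.2 hx
  refine ⟨‖Φ x‖ / 2, by positivity, ?_⟩
  exact ((isOpen_lt continuous_const hc.norm).measure_pos volume
    ⟨x, by simp only [mem_ofPred_eq]; linarith⟩).ne'

lemma exists_schwartz_bump (d : ℕ) : ∃ θ : 𝓢(Space d, ℂ),
    (∀ η, 1 / 8 < 2 * Real.pi * ‖η‖ → θ η = 0) ∧ (𝓕⁻ θ : 𝓢(Space d, ℂ)) 0 ≠ 0 := by
  -- The outer radius satisfies `2π / 64 < 1/8`, as the support condition requires. The value of `𝓕⁻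
  -- θ` at `0` is the integral of the bump, which is positive.
  let b : ContDiffBump (0 : Space d) := ⟨1 / 128, 1 / 64, by norm_num, by norm_num⟩
  have h₁ : HasCompactSupport fun x => (b x : ℂ) :=
    b.hasCompactSupport.comp_left (g := fun r : ℝ => (r : ℂ)) Complex.ofReal_zero
  have h₂ : ContDiff ℝ ∞ fun x => (b x : ℂ) := Complex.ofRealCLM.contDiff.comp b.contDiff
  refine ⟨h₁.toSchwartzMap h₂, fun η hη => ?_, ?_⟩
  · change (b η : ℂ) = 0
    rw [b.zero_of_le_dist, Complex.ofReal_zero]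
    change 1 / 64 ≤ dist η 0
    rw [dist_zero_right]
    nlinarith [Real.pi_lt_d2, norm_nonneg η]
  · rw [SchwartzMap.fourierInv_coe, Real.fourierInv_eq']
    have : ∫ x, (b x : ℂ) = ((∫ x, b x : ℝ) : ℂ) := integral_ofReal
    simp only [inner_zero_right, mul_zero, Complex.ofReal_zero, zero_mul, Complex.exp_zero,
      one_smul]
    change ∫ x, (b x : ℂ) ≠ 0
    rw [this]
    exact_mod_cast b.integral_pos.ne'

/-! ### Layered functions on the product with a discrete space -/

/-- The measure `∑ₖ wₖ |{x : (x,k) ∈ E}|` on the product of `ℝ^d` with a discrete space. -/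
noncomputable def layerMeasure (d : ℕ) {ι : Type*} [MeasurableSpace ι] (w : ι → ℝ≥0∞) :
    Measure (Space d × ι) :=
  Measure.sum fun k => w k • (volume : Measure (Space d)).map fun x => (x, k)

lemma layerMeasure_superlevel {d : ℕ} {ι : Type*} [Countable ι] [MeasurableSpace ι]
    [MeasurableSingletonClass ι] (w : ι → ℝ≥0∞) {g : Space d × ι → ℂ} (hg : Measurable g)
    {e : ℕ → ι} (he : Function.Injective e) (h0 : ∀ k ∉ range e, ∀ x, g (x, k) = 0) {t : ℝ}
    (ht : 0 < t) : layerMeasure d w {z | t < ‖g z‖} =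
      ∑' n, w (e n) * volume {x | t < ‖g (x, e n)‖} := by
  have hs : MeasurableSet {z | t < ‖g z‖} := measurableSet_lt measurable_const hg.norm
  have h1 : layerMeasure d w {z | t < ‖g z‖} = ∑' k, w k * volume {x | t < ‖g (x, k)‖} := by
    rw [layerMeasure, Measure.sum_apply _ hs]
    refine tsum_congr fun k => ?_
    rw [Measure.smul_apply, Measure.map_apply measurable_prodMk_right hs, smul_eq_mul]
    rfl
  rw [h1]
  refine (he.tsum_eq fun k hk => ?_).symm
  by_contra hne
  refine hk ?_
  have : {x : Space d | t < ‖g (x, k)‖} = ∅ := by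
    ext x
    simp [h0 k hne x, ht.le]
  simp only [this, measure_empty, mul_zero]

/-- A function on `ℝ^d × ι` whose layers of indices `e n` are dilates of `Φ` up to unimodular
factors, and whose other layers vanish. -/
structure IsLayered {d : ℕ} {ι : Type*} (g : Space d × ι → ℂ) (e : ℕ → ι) (Φ : Space d → ℂ)
    (U R : ℕ → ℝ) : Prop where
  continuous : ∀ k, Continuous fun x => g (x, k)
  eq_zero : ∀ k ∉ range e, ∀ x, g (x, k) = 0
  norm_eq : ∀ n x, ‖g (x, e n)‖ = U n * ‖Φ ((R n)⁻¹ • x)‖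

section

variable {d : ℕ} {ι : Type*} [Countable ι] [MeasurableSpace ι] [MeasurableSingletonClass ι]
  {w : ι → ℝ≥0∞} {g : Space d × ι → ℂ} {e : ℕ → ι} {Φ : Space d → ℂ} {p : ℝ} {A U R : ℕ → ℝ}

lemma IsLayered.measurable (hg : IsLayered g e Φ U R) : Measurable g :=
  measurable_from_prod_countable_left fun k => (hg.continuous k).measurable

/-- The normalization `hw` says that the weight times the dilation volume, multiplied by the `p`-th
power of the height, is `A n`. This turns the layers into the abstract superposition. -/
lemma IsLayered.superlevel_eq (hg : IsLayered g e Φ U R) (he : Function.Injective e)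
    (hU : ∀ n, 0 < U n) (hR : ∀ n, 0 < R n)
    (hw : ∀ n, w (e n) * ENNReal.ofReal (R n ^ d) = ENNReal.ofReal (A n * U n ^ (-p)))
    {t : ℝ} (ht : 0 < t) : layerMeasure d w {z | t < ‖g z‖} =
      superposedDistribution p A U (distribution Φ) t := by
  rw [layerMeasure_superlevel w hg.measurable he hg.eq_zero ht, superposedDistribution]
  refine tsum_congr fun n => ?_
  simp only [hg.norm_eq]
  rw [volume_superlevel_dilate Φ (hU n) (hR n), ← mul_assoc, hw]

end

section

variable {d : ℕ} {ι : Type*} [Countable ι] [MeasurableSpace ι] [MeasurableSingletonClass ι]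
  {w : ι → ℝ≥0∞} {g : Space d × ι → ℂ} {e : ℕ → ι} {Φ : 𝓢(Space d, ℂ)} {p σ : ℝ} {r : ℝ≥0∞}
  {A U R : ℕ → ℝ}

theorem IsLayered.memLorentz (hg : IsLayered g e Φ U R) (he : Function.Injective e) (hp : 1 < p)
    (hpr : ENNReal.ofReal p < r) (hσ : 0 < σ) (hA : ∀ n, 0 ≤ A n) (hA1 : ∀ n, A n ≤ 1)
    (hAr : r ≠ ⊤ → Summable fun n => A n ^ (r.toReal / p)) (hR : ∀ n, 0 < R n) {j : ℕ → ℤ}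
    (hj : Function.Injective j) (hU : ∀ n, U n = 2 ^ (-σ * j n))
    (hw : ∀ n, w (e n) * ENNReal.ofReal (R n ^ d) = ENNReal.ofReal (A n * U n ^ (-p))) :
    MemLorentz g p r (layerMeasure d w) := by
  obtain ⟨K, hK, hD⟩ := exists_distribution_le_peak Φ hp
  refine ⟨hg.measurable.aestronglyMeasurable,
    lorentzQuasinorm_lt_top hp hpr hσ hK hj hA hA1 hAr hD fun t ht => ?_⟩
  rw [hg.superlevel_eq he (fun n => by rw [hU]; positivity) hR hw ht]
  congr 1
  exact funext hU

theorem IsLayered.not_memLorentz_top (hg : IsLayered g e Φ U R) (he : Function.Injective e)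
    (hp : 0 < p) (hΦ : Φ 0 ≠ 0) (hA : ∀ n, 0 ≤ A n) (hR : ∀ n, 0 < R n) (hU : ∀ n, 0 < U n)
    (hblock : ∀ M : ℝ, ∃ (s : Finset ℕ) (v : ℝ), 0 < v ∧ (∀ n ∈ s, U n = v) ∧ M ≤ ∑ n ∈ s, A n)
    (hw : ∀ n, w (e n) * ENNReal.ofReal (R n ^ d) = ENNReal.ofReal (A n * U n ^ (-p))) :
    ¬ MemLorentz g p ⊤ (layerMeasure d w) := by
  obtain ⟨τ, hτ, hD⟩ := exists_distribution_ne_zero Φ.continuous hΦ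
  rintro ⟨-, h⟩
  rw [lorentzQuasinorm_top_eq_top hp hτ hA hD hblock fun t ht =>
    hg.superlevel_eq he hU hR hw ht] at h
  exact lt_irrefl _ h

end

/-- Here `hw` is the same normalization with unit weights, so layer `e n` has `L^p` norm `A n ^
(1/p)` times that of `Φ`, and the claim reduces to `A ∈ ℓ^(r/p)`. -/
theorem IsLayered.ellNorm_lt_top {d : ℕ} {ι : Type*} {g : Space d × ι → ℂ} {e : ℕ → ι}
    {Φ : 𝓢(Space d, ℂ)} {p : ℝ} {r : ℝ≥0∞} {A U R : ℕ → ℝ} (hg : IsLayered g e Φ U R)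
    (he : Function.Injective e) (hp : 0 < p) (hpr : ENNReal.ofReal p < r) (hA : ∀ n, 0 ≤ A n) (hA1 : ∀ n, A n ≤ 1)
    (hAr : r ≠ ⊤ → Summable fun n => A n ^ (r.toReal / p)) (hR : ∀ n, 0 < R n)
    (hU : ∀ n, 0 < U n) (hw : ∀ n, R n ^ d = A n * U n ^ (-p)) :
    ellNorm (fun k => eLpNorm (fun x => g (x, k)) (ENNReal.ofReal p) volume) r < ⊤ := by
  set E := eLpNorm Φ (ENNReal.ofReal p) volume with hE
  have hEtop : E ≠ ⊤ := (Φ.memLp (ENNReal.ofReal p) volume).eLpNorm_ne_top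
  have hzero : ∀ k ∉ range e, eLpNorm (fun x => g (x, k)) (ENNReal.ofReal p) volume = 0 := by
    intro k hk
    simp [hg.eq_zero k hk]
  have hnorm : ∀ n, eLpNorm (fun x => g (x, e n)) (ENNReal.ofReal p) volume =
      ENNReal.ofReal (A n ^ (1 / p)) * E := by
    intro n
    have hUn := hU n
    have h1 : eLpNorm (fun x => g (x, e n)) (ENNReal.ofReal p) volume =
        eLpNorm (U n • fun x => Φ ((R n)⁻¹ • x)) (ENNReal.ofReal p) volume := by
      refine eLpNorm_congr_norm_ae (Filter.Eventually.of_forall fun x => ?_)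
      simp only [hg.norm_eq, Pi.smul_apply, norm_smul, Real.norm_of_nonneg hUn.le]
    rw [h1, eLpNorm_const_smul, eLpNorm_dilate Φ.continuous (hR n) hp, ← mul_assoc,
      Real.enorm_of_nonneg hUn.le, ← ENNReal.ofReal_mul hUn.le, hw n,
      Real.mul_rpow (hA n) (by positivity), ← Real.rpow_mul hUn.le]
    congr 2
    rw [show -p * (1 / p) = -1 by field_simp, Real.rpow_neg_one]
    field_simp
  by_cases hr : r = ⊤
  · rw [ellNorm, if_pos hr]
    refine lt_of_le_of_lt (iSup_le fun k => ?_) hEtop.lt_top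
    by_cases hk : k ∈ range e
    · obtain ⟨n, rfl⟩ := hk
      rw [hnorm]
      refine mul_le_of_le_one_left zero_le (ENNReal.ofReal_le_one.2 ?_)
      exact Real.rpow_le_one (hA n) (hA1 n) (by positivity)
    · rw [hzero k hk]
      exact zero_le
  · have hr0 : p < r.toReal := (ENNReal.ofReal_lt_iff_lt_toReal hp.le hr).1 hpr
    have hρ0 : 0 < r.toReal := by linarith
    rw [ellNorm, if_neg hr]
    refine ENNReal.rpow_lt_top_of_nonneg (by positivity) ?_
    rw [← he.tsum_eq]
    · have : ∀ n, eLpNorm (fun x => g (x, e n)) (ENNReal.ofReal p) volume ^ r.toReal =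
          ENNReal.ofReal (A n ^ (r.toReal / p)) * E ^ r.toReal := by
        intro n
        rw [hnorm, ENNReal.mul_rpow_of_nonneg _ _ hρ0.le,
          ENNReal.ofReal_rpow_of_nonneg (Real.rpow_nonneg (hA n) _) hρ0.le,
          ← Real.rpow_mul (hA n), one_div_mul_eq_div]
      simp only [this]
      rw [ENNReal.tsum_mul_right]
      exact ENNReal.mul_ne_top (hAr hr).tsum_ofReal_ne_top
        (ENNReal.rpow_ne_top_of_nonneg hρ0.le hEtop)
    · intro k hk
      by_contra hne
      exact hk (by simp [hzero k hne, hρ0])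

/-! ### Dyadic blocks and the choice of exponents -/

/-- The largest power of two that is at most `n + 1`. -/
def dyadicFloor (n : ℕ) : ℕ := 2 ^ Nat.log 2 (n + 1)

lemma lt_two_mul_dyadicFloor (n : ℕ) : n + 1 < 2 * dyadicFloor n := by
  have := Nat.lt_pow_succ_log_self (b := 2) (by norm_num) (n + 1)
  rw [Nat.succ_eq_add_one, pow_succ] at this
  rw [dyadicFloor]
  omega

lemma dyadicFloor_eq_or_two_mul_le {m n : ℕ} (h : m < n) :
    dyadicFloor m = dyadicFloor n ∨ 2 * dyadicFloor m ≤ dyadicFloor n := by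
  rcases (Nat.log_mono_right (b := 2) (by omega : m + 1 ≤ n + 1)).eq_or_lt with h1 | h1
  · exact Or.inl (by rw [dyadicFloor, dyadicFloor, h1])
  · right
    have : 2 ^ (Nat.log 2 (m + 1) + 1) ≤ 2 ^ Nat.log 2 (n + 1) :=
      Nat.pow_le_pow_right (by norm_num) h1
    rw [pow_succ] at this
    rw [dyadicFloor, dyadicFloor]
    omega

/-- Within a block the term `ε * (n + 1)` separates the indices. Between blocks the first term jumps
by at least `4 * (dyadicFloor n - dyadicFloor m) ≥ 2 * dyadicFloor n`, which exceeds `n + 1` and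
hence the change `n - m` in the second. -/
lemma injective_mul_dyadicFloor_add {C : ℕ} (hC : 4 ≤ C) {ε : ℤ} (hε : ε = 1 ∨ ε = -1) :
    Function.Injective fun n : ℕ => (C : ℤ) * dyadicFloor n + ε * (n + 1) := by
  have key : ∀ m n : ℕ, m < n →
      (C : ℤ) * dyadicFloor m + ε * (m + 1) ≠ C * dyadicFloor n + ε * (n + 1) := by
    intro m n hmn heq
    have h1 := lt_two_mul_dyadicFloor n
    rcases dyadicFloor_eq_or_two_mul_le hmn with h | h
    · rw [h] at heq
      rcases hε with rfl | rfl <;> omega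
    · have hC' : (4 : ℤ) ≤ C := by exact_mod_cast hC
      have h' : (2 : ℤ) * dyadicFloor m ≤ dyadicFloor n := by exact_mod_cast h
      have h3 : (4 : ℤ) * (dyadicFloor n - dyadicFloor m) ≤
          C * (dyadicFloor n - dyadicFloor m) :=
        mul_le_mul_of_nonneg_right hC' (by omega)
      rw [mul_sub (C : ℤ)] at h3
      rcases hε with rfl | rfl <;> omega
  intro m n hmn
  rcases lt_trichotomy m n with h | h | h
  · exact absurd hmn (key m n h)
  · exact h
  · exact absurd hmn.symm (key n m h)

/-- The block `2^l ≤ n + 1 < 2^(l+1)` has `2^l` terms, each at least `2^(-κ(l+1))`. Its sum is at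
least `2^(-κ) * 2^(l(1-κ))`, which is unbounded because `κ < 1`. -/
lemma exists_le_sum_rpow {κ : ℝ} (hκ0 : 0 < κ) (hκ1 : κ < 1) (M : ℝ) :
    ∃ (s : Finset ℕ) (N : ℕ), (∀ n ∈ s, dyadicFloor n = N) ∧
      M ≤ ∑ n ∈ s, ((n : ℝ) + 1) ^ (-κ) := by
  obtain ⟨l, hl⟩ := pow_unbounded_of_one_lt (M * 2 ^ κ)
    (Real.one_lt_rpow (by norm_num : (1 : ℝ) < 2) (by linarith : 0 < 1 - κ))
  have hl1 : 1 ≤ 2 ^ l := Nat.one_le_two_pow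
  have hl2 : 2 ^ (l + 1) = 2 * 2 ^ l := by rw [pow_succ, mul_comm]
  refine ⟨Finset.Ico (2 ^ l - 1) (2 ^ (l + 1) - 1), 2 ^ l, fun n hn => ?_, ?_⟩
  · rw [Finset.mem_Ico] at hn
    rw [dyadicFloor, (Nat.log_eq_iff (m := l) (Or.inr ⟨by norm_num, by omega⟩)).2
      ⟨by omega, by omega⟩]
  · have hterm : ∀ n ∈ Finset.Ico (2 ^ l - 1 : ℕ) (2 ^ (l + 1) - 1),
        ((2 : ℝ) ^ (l + 1)) ^ (-κ) ≤ ((n : ℝ) + 1) ^ (-κ) := by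
      intro n hn
      rw [Finset.mem_Ico] at hn
      refine Real.rpow_le_rpow_of_nonpos (by positivity) ?_ (by linarith)
      have : n + 1 ≤ 2 ^ (l + 1) := by omega
      exact_mod_cast this
    have h := Finset.card_nsmul_le_sum _ _ _ hterm
    rw [Nat.card_Ico, show 2 ^ (l + 1) - 1 - (2 ^ l - 1) = 2 ^ l by omega, nsmul_eq_mul] at h
    refine le_trans ?_ h
    have h1 : ((2 ^ l : ℕ) : ℝ) * ((2 : ℝ) ^ (l + 1)) ^ (-κ) = (2 ^ (1 - κ)) ^ l * 2 ^ (-κ) := by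
      push_cast
      rw [← Real.rpow_natCast, ← Real.rpow_natCast, ← Real.rpow_natCast,
        ← Real.rpow_mul (by norm_num), ← Real.rpow_mul (by norm_num), ← Real.rpow_add (by norm_num),
        ← Real.rpow_add (by norm_num)]
      congr 1
      push_cast
      ring
    rw [h1, Real.rpow_neg (by norm_num), ← div_eq_mul_inv, le_div_iff₀ (by positivity)]
    exact hl.le

/-- For finite `r`, the assumption `p < r` leaves room for `κ` strictly between `p / r` and `1`; for
`r = ⊤` any `κ` in `(0, 1)` serves. -/
lemma exists_decay_exponent {p : ℝ} {r : ℝ≥0∞} (hp : 0 < p) (hpr : ENNReal.ofReal p < r) :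
    ∃ κ : ℝ, 0 < κ ∧ κ < 1 ∧
      (r ≠ ⊤ → Summable fun n : ℕ => (((n : ℝ) + 1) ^ (-κ)) ^ (r.toReal / p)) := by
  have hκ : ∃ κ : ℝ, 0 < κ ∧ κ < 1 ∧ (r ≠ ⊤ → 1 < κ * (r.toReal / p)) := by
    by_cases hr : r = ⊤
    · exact ⟨1 / 2, by norm_num, by norm_num, fun h => absurd hr h⟩
    · have hr0 : p < r.toReal := (ENNReal.ofReal_lt_iff_lt_toReal hp.le hr).1 hpr
      have hρ : 0 < r.toReal := by linarith
      have h1 : p / r.toReal < 1 := (div_lt_one hρ).2 hr0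
      obtain ⟨κ, hκ1, hκ2⟩ := exists_between h1
      refine ⟨κ, lt_trans (by positivity) hκ1, hκ2, fun _ => ?_⟩
      rw [← mul_div_assoc, lt_div_iff₀ hp, one_mul]
      rwa [div_lt_iff₀ hρ] at hκ1
  obtain ⟨κ, h0, h1, h2⟩ := hκ
  refine ⟨κ, h0, h1, fun hr => ?_⟩
  have hs := (summable_nat_add_iff 1).2 (Real.summable_nat_rpow.2
    (by linarith [h2 hr] : -(κ * (r.toReal / p)) < -1))
  refine hs.congr fun n => ?_
  rw [← Real.rpow_mul (by positivity), Nat.cast_add, Nat.cast_one]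
  congr 1
  ring

/-- This makes the bump widths at least one. The first two factors are no smaller than
`2^(-(n+1)(1+|γ|))`, and `n + 1 ≤ 2 * dyadicFloor n` lets the last factor compensate. -/
lemma one_le_mul_two_rpow {κ : ℝ} (hκ1 : κ < 1) (γ : ℝ) {D : ℝ} (hD : 2 * (1 + |γ|) ≤ D)
    (n : ℕ) : 1 ≤ ((n : ℝ) + 1) ^ (-κ) * 2 ^ (((n : ℝ) + 1) * γ) * 2 ^ (D * dyadicFloor n) := by
  have hk0 : (1 : ℝ) ≤ (n : ℝ) + 1 := by
    have : (0 : ℝ) ≤ n := Nat.cast_nonneg n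
    linarith
  have hk2 : (n : ℝ) + 1 ≤ 2 * dyadicFloor n := by exact_mod_cast (lt_two_mul_dyadicFloor n).le
  have h1 : (2 : ℝ) ^ (-((n : ℝ) + 1)) ≤ ((n : ℝ) + 1) ^ (-κ) := by
    calc (2 : ℝ) ^ (-((n : ℝ) + 1)) ≤ ((n : ℝ) + 1) ^ (-1 : ℝ) := by
          rw [Real.rpow_neg (by norm_num), Real.rpow_neg_one]
          apply inv_anti₀ (by positivity)
          have : n + 1 ≤ 2 ^ (n + 1) := (Nat.lt_two_pow_self).le
          have h : ((2 : ℝ) ^ ((n : ℝ) + 1)) = 2 ^ (n + 1) := by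
            rw [← Real.rpow_natCast]
            push_cast
            rfl
          rw [h]
          exact_mod_cast this
      _ ≤ _ := Real.rpow_le_rpow_of_exponent_le hk0 (by linarith)
  calc (1 : ℝ) ≤ 2 ^ (-((n : ℝ) + 1) + ((n : ℝ) + 1) * γ + D * dyadicFloor n) := by
        refine Real.one_le_rpow (by norm_num) ?_
        have h2 : D * dyadicFloor n ≥ (2 * (1 + |γ|)) * dyadicFloor n := by gcongr
        have h3 : ((n : ℝ) + 1) * (-|γ|) ≤ ((n : ℝ) + 1) * γ := by
          gcongr
          exact neg_abs_le γ
        have h4 : ((n : ℝ) + 1) * (1 + |γ|) ≤ 2 * dyadicFloor n * (1 + |γ|) := by gcongr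
        nlinarith
    _ = 2 ^ (-((n : ℝ) + 1)) * 2 ^ (((n : ℝ) + 1) * γ) * 2 ^ (D * dyadicFloor n) := by
        rw [Real.rpow_add (by norm_num), Real.rpow_add (by norm_num)]
    _ ≤ _ := by gcongr

/-! ### The counterexample -/

/-- A sum of one modulated bump per frequency `2^(n+1)`, of amplitude `cₙ` and width `Rₙ`, seen
through `P^b` in the homogeneous and in the inhomogeneous setting. -/
lemma exists_isLayered {d : ℕ} (hd : 1 ≤ d) (φ : LPGenerator d) {c R : ℕ → ℝ}
    (hc0 : ∀ n, 0 ≤ c n) (hR : ∀ n, 1 ≤ R n) {B : ℕ}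
    (hc : ∀ n, c n ≤ ((2 : ℝ) ^ (n + 1)) ^ B) :
    ∃ (F : SchwartzInftyDual d) (f : 𝓢'(Space d, ℂ)) (Φ : 𝓢(Space d, ℂ)), Φ 0 ≠ 0 ∧
      ∀ b : ℝ,
        IsLayered (P φ b F) (fun n : ℕ => (n : ℤ) + 1) Φ
          (fun n => 2 ^ (((n : ℝ) + 1) * b) * c n) R ∧
        IsLayered (inhomP φ b f) (fun n : ℕ => n + 1) Φ
          (fun n => 2 ^ (((n : ℝ) + 1) * b) * c n) R := by
  obtain ⟨θ, hθ, hθ0⟩ := exists_schwartz_bump d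
  have he : ‖(EuclideanSpace.single (⟨0, hd⟩ : Fin d) (1 : ℝ) : Space d)‖ = 1 := by simp
  obtain ⟨F, f, h1, h2, h3, h4⟩ := exists_lacunary_distribution he hθ hR
    (fun n => by rw [abs_of_nonneg (hc0 n)]; exact hc n) φ
  set e : Space d := EuclideanSpace.single (⟨0, hd⟩ : Fin d) (1 : ℝ)
  have hexp : ∀ (x : Space d) (n : ℕ),
      ‖Complex.exp (2 * Real.pi * Complex.I * (inner ℝ x (centerFreq e n) : ℝ))‖ = 1 := by
    intro x n
    rw [show 2 * (Real.pi : ℂ) * Complex.I * (inner ℝ x (centerFreq e n) : ℝ) =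
      ((2 * Real.pi * inner ℝ x (centerFreq e n) : ℝ) : ℂ) * Complex.I by push_cast; ring]
    exact Complex.norm_exp_ofReal_mul_I _
  have hcont : ∀ n, Continuous fun x : Space d => (c n : ℂ) *
      (Complex.exp (2 * Real.pi * Complex.I * (inner ℝ x (centerFreq e n) : ℝ)) *
        (𝓕⁻ θ : 𝓢(Space d, ℂ)) ((R n)⁻¹ • x)) := by
    intro n
    have := (𝓕⁻ θ : 𝓢(Space d, ℂ)).continuous
    fun_prop
  have hnorm : ∀ (b : ℝ) (n : ℕ) (x : Space d), ‖(((2 : ℝ) ^ (((n : ℝ) + 1) * b) : ℝ) : ℂ) *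
      ((c n : ℂ) * (Complex.exp (2 * Real.pi * Complex.I * (inner ℝ x (centerFreq e n) : ℝ)) *
        (𝓕⁻ θ : 𝓢(Space d, ℂ)) ((R n)⁻¹ • x)))‖ =
      2 ^ (((n : ℝ) + 1) * b) * c n * ‖(𝓕⁻ θ : 𝓢(Space d, ℂ)) ((R n)⁻¹ • x)‖ := by
    intro b n x
    rw [norm_mul, norm_mul, norm_mul, hexp, Complex.norm_real, Complex.norm_real,
      Real.norm_of_nonneg (hc0 n), Real.norm_of_nonneg (by positivity)]
    ring
  refine ⟨F, f, 𝓕⁻ θ, hθ0, fun b => ⟨⟨fun k => ?_, fun k hk x => ?_, fun n x => ?_⟩,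
    ⟨fun k => ?_, fun k hk x => ?_, fun n x => ?_⟩⟩⟩
  · simp only [P]
    refine continuous_const.mul ?_
    by_cases hk : ∃ n : ℕ, k = (n : ℤ) + 1
    · obtain ⟨n, rfl⟩ := hk
      exact (hcont n).congr fun x => (h1 n x).symm
    · push Not at hk
      exact continuous_const.congr fun x => (h2 k x hk).symm
  · simp only [P]
    rw [h2 k x fun n hn => hk ⟨n, hn.symm⟩, mul_zero]
  · simp only [P, h1]
    rw [← hnorm]
    push_cast
    rfl
  · simp only [inhomP]
    refine continuous_const.mul ?_
    cases k with
    | zero => exact continuous_const.congr fun x => (h4 x).symm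
    | succ n => exact (hcont n).congr fun x => (h3 n x).symm
  · cases k with
    | zero => simp only [inhomP, h4, mul_zero]
    | succ n => exact absurd ⟨n, rfl⟩ hk
  · simp only [inhomP, h3]
    rw [← hnorm]
    push_cast
    rfl

/-- One construction serves all four claims: `σ` is the rate at which the heights separate when `γ`
is replaced by `γ ± pσ`. -/
theorem exists_mem_notMem {d : ℕ} (hd : 1 ≤ d) (φ : LPGenerator d) (s : ℝ) {p : ℝ} {r : ℝ≥0∞}
    (hp : 1 < p) (hpr : ENNReal.ofReal p < r) (γ : ℝ) {σ : ℝ} (hσ : 0 < σ) :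
    ∃ (F : SchwartzInftyDual d) (f : 𝓢'(Space d, ℂ)),
      (F ∈ homBesov φ s p r ∧ f ∈ inhomBesov φ s p r) ∧
      (F ∉ homBLorentz φ s p γ ⊤ ∧ f ∉ inhomBLorentz φ s p γ ⊤) ∧
      ∀ β : ℝ, |β - γ| = p * σ → F ∈ homBLorentz φ s p β r ∧ f ∈ inhomBLorentz φ s p β r := by
  have hp0 : 0 < p := by linarith
  obtain ⟨κ, hκ0, hκ1, hAr⟩ := exists_decay_exponent hp0 hpr
  -- The bound `4` makes the exponents `j` distinct; the other bound makes the widths at least one.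
  obtain ⟨C, hC⟩ := exists_nat_ge (max 4 (2 * (1 + |γ|) / (p * σ)))
  have hC4 : 4 ≤ C := by exact_mod_cast (le_max_left _ _).trans hC
  have hCγ : 2 * (1 + |γ|) ≤ p * σ * C := by
    have := (le_max_right _ _).trans hC
    rwa [div_le_iff₀ (by positivity), mul_comm (C : ℝ)] at this
  set A : ℕ → ℝ := fun n => ((n : ℝ) + 1) ^ (-κ) with hA
  set V : ℕ → ℝ := fun n => 2 ^ (-σ * (C * dyadicFloor n)) with hV
  have hV0 : ∀ n, 0 < V n := fun n => by positivity
  have hA0 : ∀ n, 0 < A n := fun n => by positivity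
  have hA1 : ∀ n, A n ≤ 1 := fun n =>
    Real.rpow_le_one_of_one_le_of_nonpos (by simp) (by linarith)
  -- The value of `R n ^ d` forced by `2^(-(n+1)γ) * R n ^ d * V n ^ p = A n`.
  set m : ℕ → ℝ := fun n => A n * 2 ^ (((n : ℝ) + 1) * γ) * V n ^ (-p) with hm
  have hm1 : ∀ n, 1 ≤ m n := by
    intro n
    have := one_le_mul_two_rpow hκ1 γ hCγ n
    rw [show p * σ * C * dyadicFloor n = -σ * (C * dyadicFloor n) * -p by ring,
      Real.rpow_mul (by norm_num) (-σ * (C * dyadicFloor n))] at this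
    exact this
  set R : ℕ → ℝ := fun n => m n ^ (1 / (d : ℝ)) with hR
  have hR1 : ∀ n, 1 ≤ R n := fun n => Real.one_le_rpow (hm1 n) (by positivity)
  have hR0 : ∀ n, 0 < R n := fun n => lt_of_lt_of_le one_pos (hR1 n)
  have hRd : ∀ n, R n ^ d = m n := by
    intro n
    have hd0 : (d : ℝ) ≠ 0 := by
      have : d ≠ 0 := by omega
      exact_mod_cast this
    rw [hR, ← Real.rpow_natCast, ← Real.rpow_mul (by linarith [hm1 n]), one_div_mul_cancel hd0,
      Real.rpow_one]
  -- Chosen so that the heights seen through `P φ (s + γ / p)` are exactly `V n`.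
  set c : ℕ → ℝ := fun n => 2 ^ (-(((n : ℝ) + 1) * (s + γ / p))) * V n with hc
  obtain ⟨B, hB⟩ := exists_nat_ge |s + γ / p|
  have hcB : ∀ n, c n ≤ ((2 : ℝ) ^ (n + 1)) ^ B := by
    intro n
    have h1 : V n ≤ 1 := Real.rpow_le_one_of_one_le_of_nonpos (by norm_num) (by
      rw [neg_mul, neg_nonpos]
      positivity)
    have h2 : ((2 : ℝ) ^ (n + 1)) ^ B = 2 ^ (((n : ℝ) + 1) * B) := by
      rw [Real.rpow_mul (by norm_num), Real.rpow_natCast, ← Real.rpow_natCast 2 (n + 1)]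
      push_cast
      rfl
    rw [h2]
    refine (mul_le_of_le_one_right (by positivity) h1).trans
      (Real.rpow_le_rpow_of_exponent_le (by norm_num) ?_)
    rw [← mul_neg]
    gcongr
    exact (neg_le_abs _).trans hB
  obtain ⟨F, f, Φ, hΦ, hlay⟩ := exists_isLayered hd φ (fun n => by positivity) hR1 hcB
  set U : ℝ → ℕ → ℝ := fun β n => 2 ^ (((n : ℝ) + 1) * ((β - γ) / p)) * V n with hU
  have hU0 : ∀ β n, 0 < U β n := fun β n => by positivity
  have hUc : ∀ (β : ℝ) (n : ℕ), (2 : ℝ) ^ (((n : ℝ) + 1) * (s + β / p)) * c n = U β n := by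
    intro β n
    rw [hc, hU, ← mul_assoc, ← Real.rpow_add (by norm_num)]
    congr 2
    ring
  have hlayβ : ∀ β : ℝ,
      IsLayered (P φ (s + β / p) F) (fun n : ℕ => (n : ℤ) + 1) Φ (U β) R ∧
      IsLayered (inhomP φ (s + β / p) f) (fun n : ℕ => n + 1) Φ (U β) R := by
    intro β
    have := hlay (s + β / p)
    simp only [hUc] at this
    exact this
  -- The same `A n` serves every `β`: changing `β` alters the weight and the `p`-th power of the
  -- height by reciprocal factors.
  have hRU : ∀ (β : ℝ) (n : ℕ), (2 : ℝ) ^ (-((n : ℝ) + 1) * β) * R n ^ d = A n * U β n ^ (-p) := by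
    intro β n
    rw [hRd, hm, hU, Real.mul_rpow (by positivity) (hV0 n).le, ← Real.rpow_mul (by norm_num),
      show ((n : ℝ) + 1) * ((β - γ) / p) * -p = -((n : ℝ) + 1) * β + ((n : ℝ) + 1) * γ by
        field_simp; ring, Real.rpow_add (by norm_num)]
    ring
  have hinjZ : Function.Injective fun n : ℕ => (n : ℤ) + 1 := fun a b h => by simpa using h
  have hinjN : Function.Injective fun n : ℕ => n + 1 := fun a b h => by simpa using h
  have hwZ : ∀ β, ∀ n : ℕ, ENNReal.ofReal ((2 : ℝ) ^ (-(((n : ℤ) + 1 : ℤ) : ℝ) * β)) *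
      ENNReal.ofReal (R n ^ d) = ENNReal.ofReal (A n * U β n ^ (-p)) := by
    intro β n
    rw [← ENNReal.ofReal_mul (by positivity), ← hRU]
    push_cast
    rfl
  have hwN : ∀ β, ∀ n : ℕ, ENNReal.ofReal ((2 : ℝ) ^ (-((n + 1 : ℕ) : ℝ) * β)) *
      ENNReal.ofReal (R n ^ d) = ENNReal.ofReal (A n * U β n ^ (-p)) := by
    intro β n
    rw [← ENNReal.ofReal_mul (by positivity), ← hRU]
    push_cast
    rfl
  have hA0' : ∀ n, 0 ≤ A n := fun n => (hA0 n).le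
  refine ⟨F, f, ?_, ?_, fun β hβ => ?_⟩
  · have hRU0 : ∀ n, R n ^ d = A n * U 0 n ^ (-p) := by
      intro n
      rw [← hRU 0 n, mul_zero, Real.rpow_zero, one_mul]
    obtain ⟨hZ, hN⟩ := hlayβ 0
    rw [zero_div, add_zero] at hZ hN
    exact ⟨hZ.ellNorm_lt_top hinjZ hp0 hpr hA0' hA1 hAr hR0 (hU0 0) hRU0,
      hN.ellNorm_lt_top hinjN hp0 hpr hA0' hA1 hAr hR0 (hU0 0) hRU0⟩
  · have hblock : ∀ M : ℝ, ∃ (t : Finset ℕ) (v : ℝ), 0 < v ∧ (∀ n ∈ t, U γ n = v) ∧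
        M ≤ ∑ n ∈ t, A n := by
      intro M
      obtain ⟨t, N, hN, hM⟩ := exists_le_sum_rpow hκ0 hκ1 M
      refine ⟨t, 2 ^ (-σ * (C * N)), by positivity, fun n hn => ?_, hM⟩
      rw [hU, hV]
      simp only [sub_self, zero_div, mul_zero, Real.rpow_zero, one_mul, hN n hn]
    exact ⟨(hlayβ γ).1.not_memLorentz_top hinjZ hp0 hΦ hA0' hR0 (hU0 γ) hblock (hwZ γ),
      (hlayβ γ).2.not_memLorentz_top hinjN hp0 hΦ hA0' hR0 (hU0 γ) hblock (hwN γ)⟩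
  · obtain ⟨ε, hε, hβε⟩ : ∃ ε : ℤ, (ε = 1 ∨ ε = -1) ∧ (β - γ) / p = -(ε * σ) := by
      rcases abs_choice (β - γ) with h | h
      · refine ⟨-1, Or.inr rfl, ?_⟩
        rw [← h, hβ]
        push_cast
        field_simp
      · refine ⟨1, Or.inl rfl, ?_⟩
        rw [show β - γ = -(p * σ) by linarith]
        push_cast
        field_simp
    have hUj : ∀ n, U β n =
        2 ^ (-σ * (((C : ℤ) * dyadicFloor n + ε * (n + 1) : ℤ) : ℝ)) := by
      intro n
      simp only [hU, hV, hβε]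
      rw [← Real.rpow_add (by norm_num)]
      congr 1
      push_cast
      ring
    have hj := injective_mul_dyadicFloor_add hC4 hε
    exact ⟨(hlayβ β).1.memLorentz hinjZ hp hpr hσ hA0' hA1 hAr hR0 hj hUj (hwZ β),
      (hlayβ β).2.memLorentz hinjN hp hpr hσ hA0' hA1 hAr hR0 hj hUj (hwN β)⟩

end BesovLorentz

theorem theorem1p4 (d : ℕ) (hd : 1 ≤ d) (φ : BesovLorentz.LPGenerator d) (s p : ℝ) (r : ℝ≥0∞)
    (hp : 1 < p) (hpr : ENNReal.ofReal p < r) :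
    (∀ γ : ℝ, (BesovLorentz.homBesov φ s p r \ BesovLorentz.homBLorentz φ s p γ ⊤).Nonempty) ∧
    (∀ β γ : ℝ, β ≠ γ →
      (BesovLorentz.homBLorentz φ s p β r \ BesovLorentz.homBLorentz φ s p γ ⊤).Nonempty) ∧
    (∀ γ : ℝ, (BesovLorentz.inhomBesov φ s p r \ BesovLorentz.inhomBLorentz φ s p γ ⊤).Nonempty) ∧
    (∀ β γ : ℝ, β ≠ γ →
      (BesovLorentz.inhomBLorentz φ s p β r \ BesovLorentz.inhomBLorentz φ s p γ ⊤).Nonempty) := by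
  have hp0 : 0 < p := by linarith
  have key : ∀ β γ : ℝ, β ≠ γ → ∃ σ : ℝ, 0 < σ ∧ |β - γ| = p * σ := fun β γ h =>
    ⟨|β - γ| / p, div_pos (abs_pos.2 (sub_ne_zero.2 h)) hp0, by field_simp⟩
  refine ⟨fun γ => ?_, fun β γ h => ?_, fun γ => ?_, fun β γ h => ?_⟩
  · obtain ⟨F, f, hB, hL, hM⟩ := BesovLorentz.exists_mem_notMem hd φ s hp hpr γ one_pos
    exact ⟨F, hB.1, hL.1⟩
  · obtain ⟨σ, hσ, hβ⟩ := key β γ h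
    -- The Besov comparison involves no second parameter, so any positive `σ` would do.
    obtain ⟨F, f, hB, hL, hM⟩ := BesovLorentz.exists_mem_notMem hd φ s hp hpr γ hσ
    exact ⟨F, (hM β hβ).1, hL.1⟩
  · obtain ⟨F, f, hB, hL, hM⟩ := BesovLorentz.exists_mem_notMem hd φ s hp hpr γ one_pos
    exact ⟨f, hB.2, hL.2⟩
  · obtain ⟨σ, hσ, hβ⟩ := key β γ h
    obtain ⟨F, f, hB, hL, hM⟩ := BesovLorentz.exists_mem_notMem hd φ s hp hpr γ hσ
    exact ⟨f, (hM β hβ).2, hL.2⟩
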